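/- \textbf{Setting.} A weighted digraph $G=(V,E,w)$ consists of a finite set $V$, a set $E\subseteq V\times V$ of edges without self-loops (opposite pairs of edges are allowed) and weights $w:E\to(0,\infty)$. For $a,b\in V$ let $d(a,b)\in[0,\infty]$ be the minimal total weight of a directed path from $a$ to $b$ ($\infty$ if there is none), and for $t\in\mathbb R$ let $G^t$ be the digraph on $V$ with edges $\{(a,b): a\neq b,\ d(a,b)\le t\}$. For a digraph $D$ without self-loops on $V$ let $\Omega_\bullet(D)$ be its regular path complex over $\mathbb R$: $\Omega_0(D)$ is spanned by the vertices, and for $p\ge 1$, $\Omega_p(D)$ is the space of linear combinations $x$ of allowed $p$-paths $v_0\dots v_p$ (all $(v_i,v_{i+1})$ are edges of $D$) such that $\partial_p x$ is a linear combination of allowed $(p-1)$-paths, where $\partial_p(v_0\dots v_p)=\sum_i(-1)^i\,v_0\dots\widehat{v_i}\dots v_p$ and paths with two equal consecutive vertices are set to $0$. Grounded persistent path homology (GrPPH) of $G$ is the persistent real vector space $\mathcal H_1(G)$ over the poset $\mathbb R$ given by $$\mathcal H_1(G)(t)=\frac{\ker\bigl(\partial_1:\Omega_1(G\cup G^t)\to\Omega_0(G\cup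 G^t)\bigr)}{\partial_2\,\Omega_2(G^t)}\quad(t\ge 0),\qquad \mathcal H_1(G)(t)=0\quad(t<0),$$ where $G\cup G^t$ is the digraph on $V$ with all edges of $G$ and of $G^t$, and where the structure maps are induced by inclusion of chains. A barcode is a multiset of nonempty intervals of $\mathbb R$. It is a barcode of a persistent vector space $M$ if $M\cong\bigoplus_I P(I)$, the sum being over the intervals $I$ of the multiset, where $P(I)$ is the interval module of $I$. The diagram $\mathrm{Dgm}(\mathcal B)$ of a barcode $\mathcal B$ is the multiset of pairs $(\inf I,\sup I)\in[-\infty,\infty]^2$. The bottleneck distance is $$d_B(\mathcal B,\mathcal B')=\inf_\gamma\ \sup_x\ \lVert x-\gamma(x)\rVert_\infty\in[0,\infty],$$ where $\gamma$ ranges over the multi-bijections $\mathrm{Dgm}(\mathcal B)\cup\Delta\to\mathrm{Dgm}(\mathcal B')\cup\Delta$, with $\Delta=\{(x,x):x\in\mathbb R\}$ taken with multiplicity one, and where an infinite coordinate is at distance $0$ from itself and at distance $\infty$ from every other value. The medial subdivision of $G$ replaces every edge $e=(a,b)$ by two edges $(a,v_e)$ and $(v_e,b)$ through a new vertex $v_e$,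 each of weight $w(e)/2$. The iterated medial subdivisions are $G^{(0)}=G$ and $G^{(n)}=$ the medial subdivision of $G^{(n-1)}$. \textbf{Statement.} Let $G$ be any weighted digraph. Then each $\mathcal H_1(G^{(n)})$, $n\ge 0$, has a barcode, and the sequence of these barcodes converges in bottleneck distance: there is a finite barcode $\mathcal B_\infty$ such that, whenever $\mathcal B_n$ is a barcode of $\mathcal H_1(G^{(n)})$ for every $n\ge 0$, $$\lim_{n\to\infty} d_B(\mathcal B_n,\mathcal B_\infty)=0 .$$ -/

import Mathlib

open CategoryTheory Filter Topology
open scoped ENNReal DirectSum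

noncomputable section

namespace GrPPH

/-! ## Weighted digraphs -/

/-- A finite simple digraph (no self-loops; a pair of opposite edges is allowed) with positive
real weights on its edges. -/
structure WDigraph where
  V : Type
  finite : Finite V
  graph : Digraph V
  loopless : ∀ v, ¬ graph.Adj v v
  weight : {e : V × V // graph.Adj e.1 e.2} → ℝ
  weight_pos : ∀ e, 0 < weight e

namespace WDigraph

/-- The type of edges. -/
abbrev Edge (G : WDigraph) : Type := {e : G.V × G.V // G.graph.Adj e.1 e.2}

/-- Directed trails `a ⇝ b`: sequences of consecutive forward edges. -/
inductive Trail (G : WDigraph) : G.V → G.V → Type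
  | nil (a : G.V) : Trail G a a
  | cons {a b c : G.V} (h : G.graph.Adj a b) (p : Trail G b c) : Trail G a c

/-- The length of a trail is the sum of the weights of its edges. -/
def Trail.length {G : WDigraph} : {a b : G.V} → G.Trail a b → ℝ
  | _, _, .nil _ => 0
  | _, _, .cons (a := a) (b := b) h p => G.weight ⟨(a, b), h⟩ + p.length

/-- The sequence of vertices of a trail. -/
def Trail.support {G : WDigraph} : {a b : G.V} → G.Trail a b → List G.V
  | _, _, .nil a => [a]
  | _, _, .cons (a := a) _ p => a :: p.support

/-- A path is a trail that does not repeat vertices. -/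
def Trail.IsPath {G : WDigraph} {a b : G.V} (p : G.Trail a b) : Prop := p.support.Nodup

/-- The shortest-path quasimetric, with value `⊤` if there is no path. -/
def dist (G : WDigraph) (a b : G.V) : EReal :=
  ⨅ p : {p : G.Trail a b // p.IsPath}, ((p.1.length : ℝ) : EReal)

/-- The digraph `G^t` of the shortest-path filtration. -/
def filtration (G : WDigraph) (t : ℝ) : Digraph G.V where
  Adj a b := a ≠ b ∧ G.dist a b ≤ (t : EReal)

theorem filtration_mono (G : WDigraph) {s t : ℝ} (h : s ≤ t) :
    G.filtration s ≤ G.filtration t :=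
  fun _ _ hab => ⟨hab.1, hab.2.trans (EReal.coe_le_coe_iff.2 h)⟩

/-! ### Medial subdivision -/

/-- The edges of the medial subdivision: each edge `e = (a, b)` of `G` is replaced by the two edges
`(a, v_e)` and `(v_e, b)`, where `v_e` is a new vertex. -/
def medialAdj (G : WDigraph) : G.V ⊕ G.Edge → G.V ⊕ G.Edge → Prop
  | .inl a, .inr e => e.1.1 = a
  | .inr e, .inl b => e.1.2 = b
  | .inl _, .inl _ => False
  | .inr _, .inr _ => False

/-- Both halves of an edge `e` have weight `w(e) / 2`. -/
def medialWeight (G : WDigraph) :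
    (x y : G.V ⊕ G.Edge) → G.medialAdj x y → ℝ
  | .inl _, .inr e, _ => G.weight e / 2
  | .inr e, .inl _, _ => G.weight e / 2
  | .inl _, .inl _, h => h.elim
  | .inr _, .inr _, h => h.elim

/-- The medial subdivision: every edge is halved. -/
def medial (G : WDigraph) : WDigraph where
  V := G.V ⊕ G.Edge
  finite := by
    have := G.finite
    infer_instance
  graph := ⟨G.medialAdj⟩
  loopless := by
    rintro (v | e) h
    · exact h
    · exact h
  weight e := G.medialWeight e.1.1 e.1.2 e.2
  weight_pos := by
    rintro ⟨⟨a | e, b | e'⟩, h⟩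
    · exact h.elim
    · exact half_pos (G.weight_pos e')
    · exact half_pos (G.weight_pos e)
    · exact h.elim

/-- The `n`-th iterated medial subdivision. -/
def iteratedMedial (G : WDigraph) : ℕ → WDigraph
  | 0 => G
  | n + 1 => (G.iteratedMedial n).medial

end WDigraph

/-! ## Regular path complex, with real coefficients -/

/-- The real vector space `Λ_p` freely generated by all elementary `p`-paths `v₀ … v_p`. -/
def Elem (V : Type) (p : ℕ) : Type := (Fin (p + 1) → V) →₀ ℝ

instance (V : Type) (p : ℕ) : AddCommGroup (Elem V p) :=
  inferInstanceAs (AddCommGroup ((Fin (p + 1) → V) →₀ ℝ))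

instance (V : Type) (p : ℕ) : Module ℝ (Elem V p) :=
  inferInstanceAs (Module ℝ ((Fin (p + 1) → V) →₀ ℝ))

/-- The basis of elementary paths. -/
def elemBasis (V : Type) (p : ℕ) : Module.Basis (Fin (p + 1) → V) ℝ (Elem V p) :=
  Module.Basis.ofRepr (LinearEquiv.refl ℝ ((Fin (p + 1) → V) →₀ ℝ))

/-- `v_i ≠ v_{i+1}` for all `i`. -/
def IsRegular {V : Type} {p : ℕ} (v : Fin (p + 1) → V) : Prop :=
  ∀ i : Fin p, v i.castSucc ≠ v i.succ

/-- `v_i → v_{i+1}` for all `i`. -/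
def IsAllowed {V : Type} (D : Digraph V) {p : ℕ} (v : Fin (p + 1) → V) : Prop :=
  ∀ i : Fin p, D.Adj (v i.castSucc) (v i.succ)

/-- The non-regular boundary map `v₀ … v_p ↦ ∑ (-1)^i v₀ … v̂_i … v_p`, from degree `p + 1` to
degree `p`. -/
def nonregularBoundary (V : Type) (p : ℕ) : Elem V (p + 1) →ₗ[ℝ] Elem V p :=
  (elemBasis V (p + 1)).constr ℝ fun v : Fin (p + 2) → V =>
    ∑ i : Fin (p + 2), (-1 : ℝ) ^ (i : ℕ) • elemBasis V p (v ∘ i.succAbove)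

open Classical in
/-- The projection onto the span of the regular paths, killing the non-regular paths. -/
def regularProj (V : Type) (p : ℕ) : Elem V p →ₗ[ℝ] Elem V p :=
  (elemBasis V p).constr ℝ fun v : Fin (p + 1) → V =>
    if IsRegular v then elemBasis V p v else 0

/-- The regular boundary map, from degree `p + 1` to degree `p`. It is used only on spans of
allowed paths of loopless digraphs, and these paths are regular. -/
def boundary (V : Type) (p : ℕ) : Elem V (p + 1) →ₗ[ℝ] Elem V p :=
  regularProj V p ∘ₗ nonregularBoundary V p

theorem boundary_boundary (V : Type) (x : Elem V 2) : boundary V 0 (boundary V 1 x) = 0 := by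
  suffices h : boundary V 0 ∘ₗ boundary V 1 = 0 from LinearMap.congr_fun h x
  have hreg : ∀ u : Fin 1 → V, IsRegular u := fun u i => i.elim0
  have h1 : boundary V 0 ∘ₗ regularProj V 1 = boundary V 0 := by
    refine (elemBasis V 1).ext fun v => ?_
    by_cases hv : IsRegular v
    · simp [regularProj, hv]
    · have h01 : v 0 = v 1 := by
        by_contra h
        exact hv fun i => by fin_cases i; exact h
      have e : v ∘ (1 : Fin 2).succAbove = v ∘ (0 : Fin 2).succAbove := by
        funext i
        fin_cases i
        exact h01
      simp [regularProj, hv, boundary, nonregularBoundary, hreg, Fin.sum_univ_two, e]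
  rw [show boundary V 1 = regularProj V 1 ∘ₗ nonregularBoundary V 1 from rfl,
    ← LinearMap.comp_assoc, h1]
  refine (elemBasis V 2).ext fun v => ?_
  have e1 : (v ∘ (0 : Fin 3).succAbove) ∘ (0 : Fin 2).succAbove =
      (v ∘ (1 : Fin 3).succAbove) ∘ (0 : Fin 2).succAbove := by
    funext i; fin_cases i; rfl
  have e2 : (v ∘ (0 : Fin 3).succAbove) ∘ (1 : Fin 2).succAbove =
      (v ∘ (2 : Fin 3).succAbove) ∘ (0 : Fin 2).succAbove := by
    funext i; fin_cases i; rfl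
  have e3 : (v ∘ (1 : Fin 3).succAbove) ∘ (1 : Fin 2).succAbove =
      (v ∘ (2 : Fin 3).succAbove) ∘ (1 : Fin 2).succAbove := by
    funext i; fin_cases i; rfl
  have b1 : ∀ u : Fin 2 → V, boundary V 0 (elemBasis V 1 u) =
      elemBasis V 0 (u ∘ (0 : Fin 2).succAbove) - elemBasis V 0 (u ∘ (1 : Fin 2).succAbove) := by
    intro u
    simp [boundary, regularProj, nonregularBoundary, hreg, Fin.sum_univ_two, sub_eq_add_neg]
  have b2 : nonregularBoundary V 1 (elemBasis V 2 v) =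
      elemBasis V 1 (v ∘ (0 : Fin 3).succAbove) - elemBasis V 1 (v ∘ (1 : Fin 3).succAbove) +
        elemBasis V 1 (v ∘ (2 : Fin 3).succAbove) := by
    rw [nonregularBoundary, Module.Basis.constr_basis, Fin.sum_univ_three]
    simp [sub_eq_add_neg]
  rw [LinearMap.comp_apply]
  erw [b2]
  rw [map_add, map_sub, b1, b1, b1, e1, e2, e3, LinearMap.zero_apply]
  abel

/-- The span of the allowed `p`-paths. -/
def allowed {V : Type} (D : Digraph V) (p : ℕ) : Submodule ℝ (Elem V p) :=
  Submodule.span ℝ (elemBasis V p '' {v | IsAllowed D v})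

/-- The space `Ω_p` of boundary-invariant `p`-paths: allowed chains with allowed boundary. -/
def Omega {V : Type} (D : Digraph V) : (p : ℕ) → Submodule ℝ (Elem V p)
  | 0 => allowed D 0
  | p + 1 => allowed D (p + 1) ⊓ (allowed D p).comap (boundary V p)

theorem allowed_mono {V : Type} {D D' : Digraph V} (h : D ≤ D') (p : ℕ) :
    allowed D p ≤ allowed D' p :=
  Submodule.span_mono (Set.image_mono fun _ hv i => h (hv i))

theorem Omega_mono {V : Type} {D D' : Digraph V} (h : D ≤ D') : ∀ p, Omega D p ≤ Omega D' p
  | 0 => allowed_mono h 0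
  | p + 1 => inf_le_inf (allowed_mono h _) (Submodule.comap_mono (allowed_mono h p))

/-! ## Grounded persistent path homology -/

/-- The quotient `Z / B` of two subspaces `B ≤ Z` of a vector space. -/
abbrev Subquotient {M : Type} [AddCommGroup M] [Module ℝ M] (Z B : Submodule ℝ M) : Type :=
  Z ⧸ B.submoduleOf Z

/-- The map `Z / B → Z' / B'` induced by inclusions `Z ≤ Z'` and `B ≤ B'`. -/
def subquotientMap {M : Type} [AddCommGroup M] [Module ℝ M] {Z B Z' B' : Submodule ℝ M}
    (hZ : Z ≤ Z') (hB : B ≤ B') : Subquotient Z B →ₗ[ℝ] Subquotient Z' B' :=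
  Submodule.mapQ _ _ (Submodule.inclusion hZ) fun _ hx => hB hx

theorem subquotientMap_id {M : Type} [AddCommGroup M] [Module ℝ M] {Z B : Submodule ℝ M}
    (hZ : Z ≤ Z) (hB : B ≤ B) : subquotientMap hZ hB = LinearMap.id :=
  Submodule.linearMap_qext _ rfl

theorem subquotientMap_comp {M : Type} [AddCommGroup M] [Module ℝ M]
    {Z B Z' B' Z'' B'' : Submodule ℝ M} (hZ : Z ≤ Z') (hB : B ≤ B') (hZ' : Z' ≤ Z'')
    (hB' : B' ≤ B'') : subquotientMap (hZ.trans hZ') (hB.trans hB') =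
      subquotientMap hZ' hB' ∘ₗ subquotientMap hZ hB :=
  Submodule.linearMap_qext _ rfl

namespace WDigraph

open Classical in
/-- The grounded chain groups: `Ω_k(G ∪ G^t)` in degrees `k ≤ 1` and `Ω_k(G^t)` in degrees `k ≥ 2`.
The filtration starts at `t = 0`, i.e. everything vanishes for `t < 0`. -/
def groundedChains (G : WDigraph) (t : ℝ) (k : ℕ) : Submodule ℝ (Elem G.V k) :=
  if t < 0 then ⊥
  else if k ≤ 1 then Omega (G.graph ⊔ G.filtration t) k
  else Omega (G.filtration t) k

/-- Grounded `1`-cycles. -/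
def groundedCycles (G : WDigraph) (t : ℝ) : Submodule ℝ (Elem G.V 1) :=
  G.groundedChains t 1 ⊓ LinearMap.ker (boundary G.V 0)

/-- Grounded `1`-boundaries. -/
def groundedBoundaries (G : WDigraph) (t : ℝ) : Submodule ℝ (Elem G.V 1) :=
  (G.groundedChains t 2).map (boundary G.V 1)

theorem groundedChains_mono (G : WDigraph) {s t : ℝ} (h : s ≤ t) (k : ℕ) :
    G.groundedChains s k ≤ G.groundedChains t k := by
  unfold groundedChains
  by_cases hs : s < 0
  · simp [hs]
  · have ht : ¬ t < 0 := fun h' => hs (h.trans_lt h')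
    simp only [hs, ht, if_false]
    split_ifs
    · exact Omega_mono (sup_le_sup_left (G.filtration_mono h) _) k
    · exact Omega_mono (G.filtration_mono h) k

theorem groundedCycles_mono (G : WDigraph) {s t : ℝ} (h : s ≤ t) :
    G.groundedCycles s ≤ G.groundedCycles t :=
  inf_le_inf_right _ (G.groundedChains_mono h 1)

theorem groundedBoundaries_mono (G : WDigraph) {s t : ℝ} (h : s ≤ t) :
    G.groundedBoundaries s ≤ G.groundedBoundaries t :=
  Submodule.map_mono (G.groundedChains_mono h 2)

/-- Boundaries are cycles. -/
theorem groundedBoundaries_le (G : WDigraph) (t : ℝ) :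
    G.groundedBoundaries t ≤ G.groundedCycles t := by
  rintro _ ⟨x, hx, rfl⟩
  refine ⟨?_, boundary_boundary G.V x⟩
  by_cases ht : t < 0
  · have h0 : x = 0 := by simpa [groundedChains, ht] using hx
    simp [h0]
  · have hx' : x ∈ Omega (G.filtration t) 2 := by simpa [groundedChains, ht] using hx
    have h1 : boundary G.V 1 x ∈ allowed (G.filtration t) 1 := hx'.2
    have h2 : boundary G.V 1 x ∈ Omega (G.graph ⊔ G.filtration t) 1 :=
      ⟨allowed_mono le_sup_right 1 h1, by
        rw [SetLike.mem_coe, Submodule.mem_comap, boundary_boundary]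
        exact Submodule.zero_mem _⟩
    simpa [groundedChains, ht] using h2

/-- The grounded homology `H₁(G, t)`: cycles modulo boundaries. -/
abbrev groundedHomology (G : WDigraph) (t : ℝ) : Type :=
  Subquotient (G.groundedCycles t) (G.groundedBoundaries t)

/-- The map `H₁(G, s) → H₁(G, t)` induced by the inclusion of chains, for `s ≤ t`. -/
def groundedHomologyMap (G : WDigraph) {s t : ℝ} (h : s ≤ t) :
    G.groundedHomology s →ₗ[ℝ] G.groundedHomology t :=
  subquotientMap (G.groundedCycles_mono h) (G.groundedBoundaries_mono h)

end WDigraph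

/-! ## Persistent vector spaces and barcodes -/

/-- Persistent vector spaces. -/
abbrev PersVec : Type 1 := ℝ ⥤ ModuleCat.{0} ℝ

/-- Grounded persistent path homology of a weighted digraph. -/
def WDigraph.grpph (G : WDigraph) : PersVec where
  obj t := ModuleCat.of ℝ (G.groundedHomology t)
  map f := ModuleCat.ofHom (G.groundedHomologyMap (leOfHom f))
  map_id t := by
    exact congrArg ModuleCat.ofHom (subquotientMap_id _ _)
  map_comp f g := by
    exact congrArg ModuleCat.ofHom (subquotientMap_comp
      (G.groundedCycles_mono (leOfHom f)) (G.groundedBoundaries_mono (leOfHom f))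
      (G.groundedCycles_mono (leOfHom g)) (G.groundedBoundaries_mono (leOfHom g)))

/-- A nonempty interval of `ℝ`, of any kind (open, closed, half-open, bounded or not). -/
structure RealInterval where
  carrier : Set ℝ
  nonempty : carrier.Nonempty
  ordConnected : carrier.OrdConnected

open Classical in
/-- The values of the interval module `P(I)`: the line `ℝ` on `I`, and `0` elsewhere. -/
def RealInterval.fiber (I : RealInterval) (t : ℝ) : Submodule ℝ ℝ :=
  if t ∈ I.carrier then ⊤ else ⊥

open Classical in
/-- The structure maps of `P(I)`: the identity of `ℝ` if both ends are in `I`, and `0` otherwise. -/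
def RealInterval.fiberMap (I : RealInterval) (s t : ℝ) : I.fiber s →ₗ[ℝ] I.fiber t :=
  if h : s ∈ I.carrier ∧ t ∈ I.carrier then
    Submodule.inclusion (by simp [fiber, h.1, h.2])
  else 0

theorem RealInterval.coe_fiberMap (I : RealInterval) {s t : ℝ} (h : t ∈ I.carrier)
    (x : I.fiber s) : ((I.fiberMap s t x : I.fiber t) : ℝ) = x := by
  by_cases hs : s ∈ I.carrier
  · simp [fiberMap, hs, h]
  · have hx : (x : ℝ) = 0 := by simpa [fiber, hs] using x.2
    simp [fiberMap, hs, hx]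

theorem RealInterval.fiber_eq_zero (I : RealInterval) {t : ℝ} (h : t ∉ I.carrier)
    (x : I.fiber t) : (x : ℝ) = 0 := by
  simpa [fiber, h] using x.2

/-- The interval module `P(I)`. -/
def RealInterval.module (I : RealInterval) : PersVec where
  obj t := ModuleCat.of ℝ (I.fiber t)
  map {s t} _ := ModuleCat.ofHom (I.fiberMap s t)
  map_id t := by
    refine ModuleCat.hom_ext (LinearMap.ext fun x : I.fiber t => Subtype.ext ?_)
    by_cases h : t ∈ I.carrier
    · exact I.coe_fiberMap h x
    · exact (I.fiber_eq_zero h _).trans (I.fiber_eq_zero h x).symm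
  map_comp {r s t} f g := by
    refine ModuleCat.hom_ext (LinearMap.ext fun x : I.fiber r => Subtype.ext ?_)
    change ((I.fiberMap r t x : I.fiber t) : ℝ) = (I.fiberMap s t (I.fiberMap r s x) : I.fiber t)
    by_cases ht : t ∈ I.carrier
    · rw [I.coe_fiberMap ht, I.coe_fiberMap ht]
      by_cases hs : s ∈ I.carrier
      · rw [I.coe_fiberMap hs]
      · have hr : r ∉ I.carrier := fun hr =>
          hs (I.ordConnected.out hr ht ⟨leOfHom f, leOfHom g⟩)
        rw [I.fiber_eq_zero hs, I.fiber_eq_zero hr]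
    · rw [I.fiber_eq_zero ht, I.fiber_eq_zero ht]

/-- The pointwise direct sum of a family of persistent vector spaces. -/
def directSum {ι : Type} (M : ι → PersVec) : PersVec where
  obj t := ModuleCat.of ℝ (⨁ i, (M i).obj t)
  map f := ModuleCat.ofHom (DirectSum.lmap fun i => ((M i).map f).hom)
  map_id t := by
    ext x
    simp
  map_comp f g := by
    ext x
    simp

/-- A barcode: a multiset of nonempty intervals, given as a family. -/
structure Barcode where
  ι : Type
  bar : ι → RealInterval

/-- `B` is a barcode of `M`: there is an isomorphism `M ≅ ⨁_{I ∈ B} P(I)`. -/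
def IsBarcodeOf (B : Barcode) (M : PersVec) : Prop :=
  Nonempty (M ≅ directSum fun i => (B.bar i).module)

/-! ## Bottleneck distance -/

/-- The pair of endpoints `(inf I, sup I)` of an interval, in the extended plane. -/
def RealInterval.endpoints (I : RealInterval) : EReal × EReal :=
  (sInf ((fun x : ℝ => (x : EReal)) '' I.carrier), sSup ((fun x : ℝ => (x : EReal)) '' I.carrier))

/-- The multiset `Dgm(B) ∪ Δ`, as a family: the endpoints of the bars, and each point `(x, x)` of the
diagonal once. -/
def Barcode.diagram (B : Barcode) : B.ι ⊕ ℝ → EReal × EReal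
  | .inl i => (B.bar i).endpoints
  | .inr x => ((x : EReal), (x : EReal))

open Classical in
/-- `|x - y|` for extended reals; an infinite value is at distance `0` from itself and at distance
`∞` from every other value. -/
def coordDist (x y : EReal) : ℝ≥0∞ := if x = y then 0 else (x - y).abs

/-- The sup-distance of two points of the extended plane. -/
def planeDist (p q : EReal × EReal) : ℝ≥0∞ := max (coordDist p.1 q.1) (coordDist p.2 q.2)

/-- The bottleneck distance: the infimum over all multi-bijections `γ : Dgm(B) ∪ Δ → Dgm(B') ∪ Δ` of
`sup_x ‖x - γ(x)‖_∞`. -/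
def bottleneckDist (B B' : Barcode) : ℝ≥0∞ :=
  ⨅ γ : (B.ι ⊕ ℝ) ≃ (B'.ι ⊕ ℝ), ⨆ x, planeDist (B.diagram x) (B'.diagram (γ x))

end GrPPH

end

/-! For `t ≥ 0` an edge of `G^t` comes from a trail of `G` of length at most `t`, and triangles of
`G^t` replace it, modulo boundaries, by the edges of that trail. Hence every class at `t` comes from
a cycle of `G` itself: with `Z` the cycle space of `G` and `B_t` the boundaries, the homology at `t`
is `Z / (Z ∩ B_t)`, where `Z ∩ B_t` grows with `t`. A basis of `Z` adapted to this chain of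
subspaces gives a finite barcode. All bars start at `0`, so up to open or closed right ends the
barcode is determined by the dimensions at all `t ≥ 0`, and no interleaving of modules is needed.

Subdividing edges is an isomorphism from the cycles of `G` to those of its medial subdivision. Its
inverse is induced by the retraction that sends `v_e` to the head of `e`
(`edgeMap_retract_subdivide`, `subdivide_edgeMap_retract`). If all weights are at most `c`, both
maps send boundaries at `t` to boundaries at `t + c`, so each of the two dimension functions at `t +
c` is at most the other one at `t`.

Counting bars turns this into a bound on death times: the `k`-th smallest deaths differ by at most
`c` (`IsBarcodeOf.death_le_add`). Each subdivision halves the weights, so at stage `n` the bound is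
`c / 2 ^ n`. Every sorted death is thus constantly infinite or a Cauchy sequence
(`exists_limit_of_geometric`), and the limits are the deaths of the limit barcode. -/

noncomputable section

namespace GrPPH

/-! ## Chains of degree one and two -/

section Chains

variable {V W : Type}

/-- The vertex `a` as a `0`-chain. -/
def vert (a : V) : Elem V 0 := elemBasis V 0 ![a]

open Classical in
/-- The `1`-chain `ab`, which is `0` if `a = b`. -/
def edge (a b : V) : Elem V 1 := if a = b then 0 else elemBasis V 1 ![a, b]

open Classical in
/-- The `2`-chain `abc`, which is `0` if `a = b` or `b = c`. -/
def tri (a b c : V) : Elem V 2 := if a = b ∨ b = c then 0 else elemBasis V 2 ![a, b, c]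

theorem edge_self (a : V) : edge a a = 0 := if_pos rfl

theorem edge_of_ne {a b : V} (h : a ≠ b) : edge a b = elemBasis V 1 ![a, b] := if_neg h

theorem tri_of_ne {a b c : V} (h : a ≠ b) (h' : b ≠ c) :
    tri a b c = elemBasis V 2 ![a, b, c] := if_neg (not_or.2 ⟨h, h'⟩)

theorem regularProj_one_basis (v : Fin 2 → V) :
    regularProj V 1 (elemBasis V 1 v) = edge (v 0) (v 1) := by
  have hv : v = ![v 0, v 1] := by funext i; fin_cases i <;> rfl
  by_cases h : v 0 = v 1
  · rw [h, edge_self, regularProj, Module.Basis.constr_basis, if_neg fun h' => h' 0 h]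
  · rw [edge_of_ne h, regularProj, Module.Basis.constr_basis, if_pos, ← hv]
    intro i
    fin_cases i
    exact h

theorem boundary_one_basis (v : Fin 3 → V) :
    boundary V 1 (elemBasis V 2 v) = edge (v 1) (v 2) - edge (v 0) (v 2) + edge (v 0) (v 1) := by
  have h : nonregularBoundary V 1 (elemBasis V 2 v) =
      elemBasis V 1 (v ∘ (0 : Fin 3).succAbove) - elemBasis V 1 (v ∘ (1 : Fin 3).succAbove) +
        elemBasis V 1 (v ∘ (2 : Fin 3).succAbove) := by
    rw [nonregularBoundary, Module.Basis.constr_basis, Fin.sum_univ_three]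
    simp [sub_eq_add_neg]
  rw [boundary, LinearMap.comp_apply]
  erw [h]
  rw [map_add, map_sub, regularProj_one_basis, regularProj_one_basis, regularProj_one_basis]
  rfl

theorem boundary_zero_basis (v : Fin 2 → V) :
    boundary V 0 (elemBasis V 1 v) = vert (v 1) - vert (v 0) := by
  have hreg : ∀ u : Fin 1 → V, IsRegular u := fun u i => i.elim0
  have h : boundary V 0 (elemBasis V 1 v) =
      elemBasis V 0 (v ∘ (0 : Fin 2).succAbove) - elemBasis V 0 (v ∘ (1 : Fin 2).succAbove) := by
    simp [boundary, regularProj, nonregularBoundary, hreg, Fin.sum_univ_two, sub_eq_add_neg]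
  rw [h, vert, vert]
  congr 2 <;> (funext i; fin_cases i; rfl)

theorem boundary_edge (a b : V) : boundary V 0 (edge a b) = vert b - vert a := by
  by_cases h : a = b
  · rw [h, edge_self, map_zero, sub_self]
  · rw [edge_of_ne h, boundary_zero_basis]
    rfl

/-- The formula survives degeneration: if `a = b` or `b = c`, two terms cancel and the third is `0`.
Vertex maps may therefore collapse edges. -/
theorem boundary_tri (a b c : V) :
    boundary V 1 (tri a b c) = edge b c - edge a c + edge a b := by
  by_cases h : a = b
  · simp [tri, h, edge_self]
  by_cases h' : b = c
  · simp [tri, h', edge_self]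
  · rw [tri_of_ne h h', boundary_one_basis]
    rfl

theorem edge_mem_allowed {D : Digraph V} {a b : V} (h : a = b ∨ D.Adj a b) :
    edge a b ∈ allowed D 1 := by
  by_cases hab : a = b
  · rw [hab, edge_self]
    exact Submodule.zero_mem _
  · rw [edge_of_ne hab]
    refine Submodule.subset_span ⟨_, fun i => ?_, rfl⟩
    fin_cases i
    exact h.resolve_left hab

theorem tri_mem_allowed {D : Digraph V} {a b c : V} (h : a = b ∨ D.Adj a b)
    (h' : b = c ∨ D.Adj b c) : tri a b c ∈ allowed D 2 := by
  by_cases hab : a = b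
  · simp [tri, hab]
  by_cases hbc : b = c
  · simp [tri, hbc]
  · rw [tri_of_ne hab hbc]
    refine Submodule.subset_span ⟨_, fun i => ?_, rfl⟩
    fin_cases i
    · exact h.resolve_left hab
    · exact h'.resolve_left hbc

theorem tri_mem_Omega {D : Digraph V} {a b c : V} (h : a = b ∨ D.Adj a b)
    (h' : b = c ∨ D.Adj b c) (h'' : a = c ∨ D.Adj a c) : tri a b c ∈ Omega D 2 := by
  refine ⟨tri_mem_allowed h h', ?_⟩
  rw [SetLike.mem_coe, Submodule.mem_comap, boundary_tri]
  exact Submodule.add_mem _ (Submodule.sub_mem _ (edge_mem_allowed h') (edge_mem_allowed h''))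
    (edge_mem_allowed h)

/-- Without loops, `edge a b` on an edge of `D` is the basis path and not the default value `0`. -/
theorem allowed_one_le {D : Digraph V} {S : Submodule ℝ (Elem V 1)}
    (hD : ∀ v, ¬ D.Adj v v) (h : ∀ a b, D.Adj a b → edge a b ∈ S) : allowed D 1 ≤ S := by
  refine Submodule.span_le.2 ?_
  rintro _ ⟨v, hv, rfl⟩
  have hv' : v = ![v 0, v 1] := by funext i; fin_cases i <;> rfl
  have h01 : D.Adj (v 0) (v 1) := hv 0
  have := h _ _ h01
  have hne : v 0 ≠ v 1 := fun e => hD (v 1) (by rwa [e] at h01)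
  rwa [edge_of_ne hne, ← hv'] at this

/-- Every `0`-path is vacuously allowed, so the boundary condition is empty in degree one. -/
theorem Omega_one (D : Digraph V) : Omega D 1 = allowed D 1 := by
  refine inf_eq_left.2 fun x _ => ?_
  rw [Submodule.mem_comap]
  have h : allowed D 0 = ⊤ := by
    rw [allowed, ← (elemBasis V 0).span_eq, ← Set.image_univ]
    exact congrArg _ (congrArg _ (Set.eq_univ_of_forall fun v i => i.elim0))
  rw [h]
  trivial

/-- The map of `1`-chains induced by a map of vertices. -/
def edgeMap (f : V → W) : Elem V 1 →ₗ[ℝ] Elem W 1 :=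
  (elemBasis V 1).constr ℝ fun v => edge (f (v 0)) (f (v 1))

/-- The map of `0`-chains induced by a map of vertices. -/
def vertMap (f : V → W) : Elem V 0 →ₗ[ℝ] Elem W 0 :=
  (elemBasis V 0).constr ℝ fun v => vert (f (v 0))

/-- The map of `2`-chains induced by a map of vertices. -/
def triMap (f : V → W) : Elem V 2 →ₗ[ℝ] Elem W 2 :=
  (elemBasis V 2).constr ℝ fun v => tri (f (v 0)) (f (v 1)) (f (v 2))

theorem edgeMap_edge (f : V → W) (a b : V) : edgeMap f (edge a b) = edge (f a) (f b) := by
  by_cases h : a = b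
  · rw [h, edge_self, edge_self, map_zero]
  · rw [edge_of_ne h, edgeMap, Module.Basis.constr_basis]
    rfl

theorem vertMap_vert (f : V → W) (a : V) : vertMap f (vert a) = vert (f a) := by
  rw [vert, vertMap, Module.Basis.constr_basis]
  rfl

theorem boundary_edgeMap (f : V → W) (x : Elem V 1) :
    boundary W 0 (edgeMap f x) = vertMap f (boundary V 0 x) := by
  suffices h : boundary W 0 ∘ₗ edgeMap f = vertMap f ∘ₗ boundary V 0 from LinearMap.congr_fun h x
  refine (elemBasis V 1).ext fun v => ?_
  rw [LinearMap.comp_apply, LinearMap.comp_apply, edgeMap, Module.Basis.constr_basis,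
    boundary_edge, boundary_zero_basis, map_sub, vertMap_vert, vertMap_vert]

theorem boundary_triMap (f : V → W) (x : Elem V 2) :
    boundary W 1 (triMap f x) = edgeMap f (boundary V 1 x) := by
  suffices h : boundary W 1 ∘ₗ triMap f = edgeMap f ∘ₗ boundary V 1 from LinearMap.congr_fun h x
  refine (elemBasis V 2).ext fun v => ?_
  rw [LinearMap.comp_apply, LinearMap.comp_apply, triMap, Module.Basis.constr_basis, boundary_tri,
    boundary_one_basis]
  simp only [map_add, map_sub, edgeMap_edge]

/-- Collapsed edges give zero chains, so both `triMap f` and `edgeMap f` preserve allowed chains;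
they commute with the boundary by `boundary_triMap`. -/
theorem triMap_mem_Omega {D : Digraph V} {D' : Digraph W} {f : V → W}
    (hf : ∀ a b, D.Adj a b → f a = f b ∨ D'.Adj (f a) (f b)) {x : Elem V 2} (hx : x ∈ Omega D 2) :
    triMap f x ∈ Omega D' 2 := by
  have h1 : allowed D 1 ≤ (allowed D' 1).comap (edgeMap f) := by
    refine Submodule.span_le.2 ?_
    rintro _ ⟨v, hv, rfl⟩
    rw [SetLike.mem_coe, Submodule.mem_comap, edgeMap, Module.Basis.constr_basis]
    exact edge_mem_allowed (hf _ _ (hv 0))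
  have h2 : allowed D 2 ≤ (allowed D' 2).comap (triMap f) := by
    refine Submodule.span_le.2 ?_
    rintro _ ⟨v, hv, rfl⟩
    rw [SetLike.mem_coe, Submodule.mem_comap, triMap, Module.Basis.constr_basis]
    exact tri_mem_allowed (hf _ _ (hv 0)) (hf _ _ (hv 1))
  refine ⟨h2 hx.1, ?_⟩
  rw [SetLike.mem_coe, Submodule.mem_comap, boundary_triMap]
  exact h1 hx.2

end Chains
namespace WDigraph

/-! ## The shortest-path quasimetric -/

theorem Trail.length_nonneg {G : WDigraph} : ∀ {a b : G.V} (p : G.Trail a b), 0 ≤ p.length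
  | _, _, .nil _ => le_rfl
  | _, _, .cons _ p => add_nonneg (G.weight_pos _).le p.length_nonneg

theorem Trail.support_ne_nil {G : WDigraph} {a b : G.V} (p : G.Trail a b) : p.support ≠ [] := by
  cases p <;> simp [Trail.support]

theorem Trail.head_support {G : WDigraph} {a b : G.V} (p : G.Trail a b) :
    p.support.head? = some a := by
  cases p <;> rfl

/-- Two vertices are joined by at most one edge in each direction, so the vertex sequence determines
the trail. -/
theorem Trail.support_injective {G : WDigraph} :
    ∀ {a b : G.V} (p q : G.Trail a b), p.support = q.support → p = q
  | _, _, .nil _, .nil _, _ => rfl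
  | _, _, .nil _, .cons _ q, h => (q.support_ne_nil (by simpa [Trail.support] using h)).elim
  | _, _, .cons _ p, .nil _, h => (p.support_ne_nil (by simpa [Trail.support] using h)).elim
  | _, _, .cons (b := b) h₁ p, .cons (b := b') h₂ q, h => by
    have h' : p.support = q.support := by simpa [Trail.support] using h
    have hb : b = b' := by
      have := congrArg List.head? h'
      rwa [p.head_support, q.head_support, Option.some_inj] at this
    subst hb
    rw [Trail.support_injective p q h']

theorem finite_paths (G : WDigraph) (a b : G.V) : Finite {p : G.Trail a b // p.IsPath} := by
  classical
  have := G.finite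
  have := Fintype.ofFinite G.V
  refine Finite.of_injective (β := {l : List G.V // l.Nodup}) (fun p => ⟨p.1.support, p.2⟩) ?_
  intro p q h
  exact Subtype.ext (Trail.support_injective _ _ (congrArg Subtype.val h))

theorem Trail.exists_suffix {G : WDigraph} : ∀ {b c : G.V} (q : G.Trail b c) (a : G.V),
    a ∈ q.support → ∃ q' : G.Trail a c, q'.length ≤ q.length ∧ q'.support <:+ q.support
  | _, _, .nil b, a, h => by
    obtain rfl : a = b := by simpa [Trail.support] using h
    exact ⟨.nil a, le_rfl, List.suffix_rfl⟩
  | b, _, .cons e q, a, h => by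
    by_cases hab : a = b
    · subst hab
      exact ⟨.cons e q, le_rfl, List.suffix_rfl⟩
    · have h' : a ∈ q.support := by simpa [Trail.support, hab] using h
      obtain ⟨q', h1, h2⟩ := q.exists_suffix a h'
      exact ⟨q', h1.trans (le_add_of_nonneg_left (G.weight_pos _).le),
        h2.trans (List.suffix_cons _ _)⟩

/-- Cutting out the loop at a repeated vertex does not lengthen the trail, as weights are positive.
-/
theorem Trail.exists_isPath {G : WDigraph} : ∀ {a b : G.V} (p : G.Trail a b),
    ∃ q : G.Trail a b, q.IsPath ∧ q.length ≤ p.length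
  | _, _, .nil a => ⟨.nil a, List.nodup_singleton a, le_rfl⟩
  | a, _, .cons e p => by
    obtain ⟨q, hq, hl⟩ := p.exists_isPath
    by_cases h : a ∈ q.support
    · obtain ⟨q', h1, h2⟩ := q.exists_suffix a h
      exact ⟨q', hq.sublist h2.sublist,
        h1.trans (hl.trans (le_add_of_nonneg_left (G.weight_pos _).le))⟩
    · exact ⟨.cons e q, List.nodup_cons.2 ⟨h, hq⟩, add_le_add_right hl _⟩

/-- The infimum runs over finitely many paths, so it is attained when there is one. Passing from
paths to trails removes the condition on repeated vertices from all later constructions. -/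
theorem dist_le_iff (G : WDigraph) (a b : G.V) (t : ℝ) :
    G.dist a b ≤ (t : EReal) ↔ ∃ p : G.Trail a b, p.length ≤ t := by
  constructor
  · intro h
    have := G.finite_paths a b
    cases isEmpty_or_nonempty {p : G.Trail a b // p.IsPath} with
    | inl _ =>
      rw [dist, iInf_of_empty, top_le_iff] at h
      exact (EReal.coe_ne_top _ h).elim
    | inr _ =>
      obtain ⟨p, hp⟩ := exists_eq_ciInf_of_finite
        (f := fun p : {p : G.Trail a b // p.IsPath} => ((p.1.length : ℝ) : EReal))
      refine ⟨p.1, EReal.coe_le_coe_iff.1 ?_⟩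
      exact hp.le.trans h
  · rintro ⟨p, hp⟩
    obtain ⟨q, hq, hl⟩ := p.exists_isPath
    exact (iInf_le _ (⟨q, hq⟩ : {p : G.Trail a b // p.IsPath})).trans
      (EReal.coe_le_coe_iff.2 (hl.trans hp))

theorem eq_or_filtration_adj (G : WDigraph) {a b : G.V} {t : ℝ} (p : G.Trail a b)
    (h : p.length ≤ t) : a = b ∨ (G.filtration t).Adj a b :=
  or_iff_not_imp_left.2 fun hab => ⟨hab, (G.dist_le_iff a b t).2 ⟨p, h⟩⟩

theorem not_filtration_zero_adj (G : WDigraph) (a b : G.V) : ¬ (G.filtration 0).Adj a b := by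
  rintro ⟨hab, h⟩
  obtain ⟨p, hp⟩ := (G.dist_le_iff a b 0).1 h
  cases p with
  | nil => exact hab rfl
  | cons e p => exact (add_pos_of_pos_of_nonneg (G.weight_pos _) p.length_nonneg).not_ge hp

/-! ### Trails in the medial subdivision -/

theorem exists_trail_medial_inl (G : WDigraph) : ∀ {a b : G.V} (p : G.Trail a b),
    ∃ q : G.medial.Trail (.inl a : G.V ⊕ G.Edge) (.inl b : G.V ⊕ G.Edge), q.length = p.length
  | _, _, .nil a => ⟨.nil (G := G.medial) (.inl a : G.V ⊕ G.Edge), rfl⟩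
  | a, _, .cons (b := b) e p => by
    obtain ⟨q, hq⟩ := G.exists_trail_medial_inl p
    let v : G.V ⊕ G.Edge := .inr ⟨(a, b), e⟩
    have h1 : G.medial.graph.Adj (.inl a : G.V ⊕ G.Edge) v := rfl
    have h2 : G.medial.graph.Adj v (.inl b : G.V ⊕ G.Edge) := rfl
    refine ⟨.cons h1 (.cons h2 q), ?_⟩
    change G.weight ⟨(a, b), e⟩ / 2 + (G.weight ⟨(a, b), e⟩ / 2 + q.length) =
      G.weight ⟨(a, b), e⟩ + p.length
    rw [hq]
    ring

/-- The retraction of the vertices of the medial subdivision that sends `v_e` to the head of `e`. -/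
def medialHead (G : WDigraph) : G.V ⊕ G.Edge → G.V
  | .inl a => a
  | .inr e => e.1.2

/-- The length that `medialHead` adds in front of a vertex. -/
def medialShift (G : WDigraph) : G.V ⊕ G.Edge → ℝ
  | .inl _ => 0
  | .inr e => G.weight e / 2

/-- Moving an endpoint `v_e` to the head of `e` costs `w(e) / 2` at the end of a trail and saves as
much at its start. Recording the saving on the left makes the induction over half-edges close. -/
theorem exists_trail_medialHead (G : WDigraph) : ∀ {x y : G.V ⊕ G.Edge}
    (p : Trail G.medial x y), ∃ q : G.Trail (G.medialHead x) (G.medialHead y),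
      q.length + G.medialShift x ≤ p.length + G.medialShift y
  | _, _, .nil x => ⟨.nil _, le_rfl⟩
  | .inl a, _, .cons (b := Sum.inl b) h p => (h : False).elim
  | .inr a, _, .cons (b := Sum.inr b) h p => (h : False).elim
  | .inl a, y, .cons (b := Sum.inr ⟨(a', b), e⟩) h p => by
    obtain ⟨q, hq⟩ := G.exists_trail_medialHead p
    obtain rfl : a' = a := h
    refine ⟨.cons (a := a') (b := b) e q, ?_⟩
    change G.weight ⟨(a', b), e⟩ + q.length + 0 ≤
      G.weight ⟨(a', b), e⟩ / 2 + p.length + G.medialShift y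
    change q.length + G.weight ⟨(a', b), e⟩ / 2 ≤ _ at hq
    linarith
  | .inr ⟨(a, b'), e⟩, y, .cons (b := Sum.inl b) h p => by
    obtain ⟨q, hq⟩ := G.exists_trail_medialHead p
    obtain rfl : b' = b := h
    refine ⟨q, ?_⟩
    change q.length + G.weight ⟨(a, b'), e⟩ / 2 ≤
      G.weight ⟨(a, b'), e⟩ / 2 + p.length + G.medialShift y
    change q.length + 0 ≤ _ at hq
    linarith

end WDigraph

/-! ### Dimension counts for subspaces and subquotients. -/

instance (V : Type) [Finite V] (p : ℕ) : Module.Finite ℝ (Elem V p) :=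
  Module.Finite.of_basis (elemBasis V p)

theorem finrank_le_of_leftInverse {E F : Type} [AddCommGroup E] [Module ℝ E] [AddCommGroup F]
    [Module ℝ F] [Module.Finite ℝ F] {S : Submodule ℝ E} {S' : Submodule ℝ F} (f : E →ₗ[ℝ] F)
    (g : F →ₗ[ℝ] E) (h : ∀ x ∈ S, f x ∈ S') (hg : ∀ x ∈ S, g (f x) = x) :
    Module.finrank ℝ S ≤ Module.finrank ℝ S' := by
  refine LinearMap.finrank_le_finrank_of_injective (f := f.restrict h) fun x y hxy => Subtype.ext ?_
  have : f x = f y := congrArg Subtype.val hxy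
  rw [← hg x x.2, ← hg y y.2, this]

/-- Rank-nullity for `Z₀ → Z / B`: the map is onto by hypothesis, and its kernel is `Z₀ ⊓ B`. -/
theorem finrank_subquotient_add {M : Type} [AddCommGroup M] [Module ℝ M] [Module.Finite ℝ M]
    {Z₀ Z B : Submodule ℝ M} (hZ : Z₀ ≤ Z) (h : ∀ x ∈ Z, ∃ z ∈ Z₀, z - x ∈ B) :
    Module.finrank ℝ (Subquotient Z B) + Module.finrank ℝ (Z₀ ⊓ B : Submodule ℝ M) =
      Module.finrank ℝ Z₀ := by
  let φ : Z₀ →ₗ[ℝ] Subquotient Z B := (B.submoduleOf Z).mkQ ∘ₗ Submodule.inclusion hZ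
  have hφ : LinearMap.range φ = ⊤ := by
    refine LinearMap.range_eq_top.2 fun y => ?_
    obtain ⟨⟨x, hx⟩, rfl⟩ := Submodule.mkQ_surjective _ y
    obtain ⟨z, hz, hzx⟩ := h x hx
    exact ⟨⟨z, hz⟩, (Submodule.Quotient.eq _).2 hzx⟩
  have hker : LinearMap.ker φ = B.comap Z₀.subtype := by
    ext z
    exact Submodule.Quotient.mk_eq_zero _
  have h := φ.finrank_range_add_finrank_ker
  rwa [hφ, finrank_top, hker, ← Submodule.finrank_map_subtype_eq, Submodule.map_comap_subtype] at h

namespace WDigraph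

variable (G : WDigraph)

instance : Finite G.V := G.finite

/-! ## Grounded homology in degree one -/

theorem mem_groundedCycles {t : ℝ} (ht : 0 ≤ t) {x : Elem G.V 1} :
    x ∈ G.groundedCycles t ↔
      x ∈ allowed (G.graph ⊔ G.filtration t) 1 ∧ boundary G.V 0 x = 0 := by
  rw [groundedCycles, groundedChains, if_neg ht.not_gt, if_pos le_rfl, Omega_one]
  rfl

theorem mem_groundedBoundaries {t : ℝ} (ht : 0 ≤ t) {x : Elem G.V 1} :
    x ∈ G.groundedBoundaries t ↔ ∃ y ∈ Omega (G.filtration t) 2, boundary G.V 1 y = x := by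
  rw [groundedBoundaries, groundedChains, if_neg ht.not_gt, if_neg (by norm_num)]
  rfl

theorem mem_groundedCycles_zero {x : Elem G.V 1} :
    x ∈ G.groundedCycles 0 ↔ x ∈ allowed G.graph 1 ∧ boundary G.V 0 x = 0 := by
  have h : G.graph ⊔ G.filtration 0 = G.graph :=
    sup_eq_left.2 fun a b h => (G.not_filtration_zero_adj a b h).elim
  rw [G.mem_groundedCycles le_rfl, h]

theorem groundedBoundaries_zero : G.groundedBoundaries 0 = ⊥ := by
  refine (Submodule.eq_bot_iff _).2 fun x hx => ?_
  obtain ⟨y, hy, rfl⟩ := (G.mem_groundedBoundaries le_rfl).1 hx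
  have h : allowed (G.filtration 0) 2 ≤ ⊥ := by
    refine Submodule.span_le.2 ?_
    rintro _ ⟨v, hv, rfl⟩
    exact (G.not_filtration_zero_adj _ _ (hv 0)).elim
  rw [(Submodule.mem_bot ℝ).1 (h hy.1), map_zero]

theorem subsingleton_groundedHomology {t : ℝ} (ht : t < 0) :
    Subsingleton (G.groundedHomology t) := by
  have h : G.groundedCycles t = ⊥ := by
    rw [groundedCycles, groundedChains, if_pos ht, bot_inf_eq]
  have : Subsingleton (G.groundedCycles t) := by
    rw [h]
    infer_instance
  infer_instance

/-- An edge of `G^t` is homologous in `G^t` to a chain of `G`. -/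
theorem edge_mem_of_trail (G : WDigraph) {t : ℝ} (ht : 0 ≤ t) :
    ∀ {a b : G.V} (p : G.Trail a b), p.length ≤ t →
      edge a b ∈ allowed G.graph 1 ⊔ G.groundedBoundaries t
  | _, _, .nil a, _ => by
    rw [edge_self]
    exact Submodule.zero_mem _
  | a, b, .cons (b := c) e p, h => by
    have hp : p.length ≤ t := (le_add_of_nonneg_left (G.weight_pos _).le).trans h
    have he : (Trail.cons e (.nil c)).length ≤ t :=
      (add_le_add_right p.length_nonneg (G.weight ⟨(a, c), e⟩)).trans h
    have h1 : edge c b ∈ allowed G.graph 1 ⊔ G.groundedBoundaries t := G.edge_mem_of_trail ht p hp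
    have h2 : edge a c ∈ allowed G.graph 1 ⊔ G.groundedBoundaries t :=
      Submodule.mem_sup_left (edge_mem_allowed (.inr e))
    -- The triangle through the first intermediate vertex `c` trades `ab` for `ac + cb`. Its three
    -- sides are spanned by trails of length at most `t`.
    have h3 : boundary G.V 1 (tri a c b) ∈ allowed G.graph 1 ⊔ G.groundedBoundaries t :=
      Submodule.mem_sup_right ((G.mem_groundedBoundaries ht).2 ⟨_, tri_mem_Omega
        (G.eq_or_filtration_adj _ he) (G.eq_or_filtration_adj p hp)
        (G.eq_or_filtration_adj _ h), rfl⟩)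
    have h4 := Submodule.sub_mem _ (Submodule.add_mem _ h1 h2) h3
    rw [boundary_tri] at h4
    convert h4 using 1
    abel

theorem allowed_le_sup {t : ℝ} (ht : 0 ≤ t) : allowed (G.graph ⊔ G.filtration t) 1 ≤
    allowed G.graph 1 ⊔ G.groundedBoundaries t := by
  refine allowed_one_le ?_ ?_
  · rintro v (h | h)
    · exact G.loopless v h
    · exact h.1 rfl
  · rintro a b (h | h)
    · exact Submodule.mem_sup_left (edge_mem_allowed (.inr h))
    · obtain ⟨p, hp⟩ := (G.dist_le_iff a b t).1 h.2
      exact G.edge_mem_of_trail ht p hp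

/-- In a splitting of the cycle `x` into a chain of `G` and a boundary, the first part is again a
cycle. -/
theorem exists_sub_mem_groundedBoundaries {t : ℝ} (ht : 0 ≤ t) {x : Elem G.V 1}
    (hx : x ∈ G.groundedCycles t) :
    ∃ z ∈ G.groundedCycles 0, z - x ∈ G.groundedBoundaries t := by
  obtain ⟨hx1, hx2⟩ := (G.mem_groundedCycles ht).1 hx
  obtain ⟨z, hz, y, hy, rfl⟩ := Submodule.mem_sup.1 (G.allowed_le_sup ht hx1)
  have hy0 : boundary G.V 0 y = 0 :=
    ((G.mem_groundedCycles ht).1 (G.groundedBoundaries_le t hy)).2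
  refine ⟨z, G.mem_groundedCycles_zero.2 ⟨hz, ?_⟩, ?_⟩
  · rwa [map_add, hy0, add_zero] at hx2
  · rw [sub_add_cancel_left]
    exact Submodule.neg_mem _ hy

theorem groundedHomologyMap_surjective {t : ℝ} (ht : 0 ≤ t) :
    Function.Surjective (G.groundedHomologyMap ht) := by
  intro y
  obtain ⟨⟨x, hx⟩, rfl⟩ := Submodule.mkQ_surjective _ y
  obtain ⟨z, hz, h⟩ := G.exists_sub_mem_groundedBoundaries ht hx
  exact ⟨Submodule.mkQ _ ⟨z, hz⟩, (Submodule.Quotient.eq _).2 h⟩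

/-- Reduces the comparison of homology dimensions to the subspaces of cycles of the graph that bound
at `t`. -/
theorem finrank_groundedHomology {t : ℝ} (ht : 0 ≤ t) :
    Module.finrank ℝ (G.groundedHomology t) +
      Module.finrank ℝ (G.groundedCycles 0 ⊓ G.groundedBoundaries t : Submodule ℝ (Elem G.V 1)) =
        Module.finrank ℝ (G.groundedCycles 0) := by
  exact finrank_subquotient_add (G.groundedCycles_mono ht)
    fun x hx => G.exists_sub_mem_groundedBoundaries ht hx

/-! ## Medial subdivision and grounded homology -/

/-- A vertex of `G`, as a vertex of the medial subdivision. -/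
def old (a : G.V) : G.medial.V := (Sum.inl a : G.V ⊕ G.Edge)

/-- The new vertex on an edge. -/
def mid (e : G.Edge) : G.medial.V := (Sum.inr e : G.V ⊕ G.Edge)

/-- The retraction of the medial subdivision that collapses the second half of each edge. -/
def retract : G.medial.V → G.V := G.medialHead

theorem adj_old_mid (e : G.Edge) : G.medial.graph.Adj (G.old e.1.1) (G.mid e) := rfl

theorem adj_mid_old (e : G.Edge) : G.medial.graph.Adj (G.mid e) (G.old e.1.2) := rfl

theorem exists_of_medial_adj {x y : G.medial.V} (h : G.medial.graph.Adj x y) :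
    (∃ e, x = G.old e.1.1 ∧ y = G.mid e) ∨ ∃ e, x = G.mid e ∧ y = G.old e.1.2 := by
  rcases x with a | e <;> rcases y with b | e'
  · exact (h : False).elim
  · obtain rfl : e'.1.1 = a := h
    exact .inl ⟨e', rfl, rfl⟩
  · obtain rfl : e.1.2 = b := h
    exact .inr ⟨e, rfl, rfl⟩
  · exact (h : False).elim

open Classical in
/-- The `2`-chains `a v_e b` between an edge `e = (a, b)` and its subdivision. -/
def medialTri : Elem G.V 1 →ₗ[ℝ] Elem G.medial.V 2 :=
  (elemBasis G.V 1).constr ℝ fun v =>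
    if h : G.graph.Adj (v 0) (v 1) then
      tri (G.old (v 0)) (G.mid ⟨(v 0, v 1), h⟩) (G.old (v 1)) else 0

/-- The subdivision of chains of `G`. -/
def subdivide : Elem G.V 1 →ₗ[ℝ] Elem G.medial.V 1 :=
  edgeMap G.old + boundary G.medial.V 1 ∘ₗ G.medialTri

theorem medialTri_edge (e : G.Edge) : G.medialTri (edge e.1.1 e.1.2) =
    tri (G.old e.1.1) (G.mid e) (G.old e.1.2) := by
  have hne : e.1.1 ≠ e.1.2 := fun h => G.loopless e.1.2 (by simpa only [h] using e.2)
  rw [edge_of_ne hne, medialTri, Module.Basis.constr_basis]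
  exact dif_pos e.2

theorem subdivide_edge (e : G.Edge) : G.subdivide (edge e.1.1 e.1.2) =
    edge (G.old e.1.1) (G.mid e) + edge (G.mid e) (G.old e.1.2) := by
  rw [subdivide, LinearMap.add_apply, edgeMap_edge, LinearMap.comp_apply, medialTri_edge,
    boundary_tri]
  abel

theorem allowed_graph_le {S : Submodule ℝ (Elem G.V 1)}
    (h : ∀ e : G.Edge, edge e.1.1 e.1.2 ∈ S) : allowed G.graph 1 ≤ S :=
  allowed_one_le G.loopless fun a b hab => h ⟨(a, b), hab⟩

theorem allowed_medial_le {S : Submodule ℝ (Elem G.medial.V 1)}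
    (h1 : ∀ e : G.Edge, edge (G.old e.1.1) (G.mid e) ∈ S)
    (h2 : ∀ e : G.Edge, edge (G.mid e) (G.old e.1.2) ∈ S) : allowed G.medial.graph 1 ≤ S := by
  refine allowed_one_le G.medial.loopless fun x y h => ?_
  obtain ⟨e, rfl, rfl⟩ | ⟨e, rfl, rfl⟩ := G.exists_of_medial_adj h
  · exact h1 e
  · exact h2 e

theorem subdivide_mem {x : Elem G.V 1} (hx : x ∈ G.groundedCycles 0) :
    G.subdivide x ∈ G.medial.groundedCycles 0 := by
  obtain ⟨hx1, hx2⟩ := G.mem_groundedCycles_zero.1 hx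
  refine G.medial.mem_groundedCycles_zero.2 ⟨?_, ?_⟩
  · have h : allowed G.graph 1 ≤ (allowed G.medial.graph 1).comap G.subdivide :=
      G.allowed_graph_le fun e => by
        rw [Submodule.mem_comap, subdivide_edge]
        exact Submodule.add_mem _ (edge_mem_allowed (.inr (G.adj_old_mid e)))
          (edge_mem_allowed (.inr (G.adj_mid_old e)))
    exact h hx1
  · rw [subdivide, LinearMap.add_apply, map_add, LinearMap.comp_apply, boundary_boundary,
      boundary_edgeMap, hx2, map_zero, add_zero]

theorem edgeMap_retract_mem {x : Elem G.medial.V 1} (hx : x ∈ G.medial.groundedCycles 0) :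
    edgeMap G.retract x ∈ G.groundedCycles 0 := by
  obtain ⟨hx1, hx2⟩ := G.medial.mem_groundedCycles_zero.1 hx
  refine G.mem_groundedCycles_zero.2 ⟨?_, ?_⟩
  · have h : allowed G.medial.graph 1 ≤ (allowed G.graph 1).comap (edgeMap G.retract) := by
      refine G.allowed_medial_le (fun e => ?_) fun e => ?_
      · rw [Submodule.mem_comap, edgeMap_edge]
        exact edge_mem_allowed (.inr e.2)
      · rw [Submodule.mem_comap, edgeMap_edge]
        exact edge_mem_allowed (.inl rfl)
    exact h hx1
  · rw [boundary_edgeMap, hx2, map_zero]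

/-- The first half of an edge `e` retracts onto `e`, the second onto a vertex, so this holds for all
chains of `G`. -/
theorem edgeMap_retract_subdivide {x : Elem G.V 1} (hx : x ∈ G.groundedCycles 0) :
    edgeMap G.retract (G.subdivide x) = x := by
  have h : allowed G.graph 1 ≤
      LinearMap.ker (edgeMap G.retract ∘ₗ G.subdivide - LinearMap.id) := by
    refine G.allowed_graph_le fun e => ?_
    rw [LinearMap.mem_ker, LinearMap.sub_apply, LinearMap.comp_apply, subdivide_edge, map_add,
      edgeMap_edge, edgeMap_edge]
    change edge e.1.1 e.1.2 + edge e.1.2 e.1.2 - edge e.1.1 e.1.2 = 0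
    rw [edge_self, add_zero, sub_self]
  exact sub_eq_zero.1 (h (G.mem_groundedCycles_zero.1 hx).1)

/-- The linear map that sends a new vertex `v_e` to the second half of `e`, and the vertices of `G`
to `0`. -/
def secondHalf : Elem G.medial.V 0 →ₗ[ℝ] Elem G.medial.V 1 :=
  (elemBasis G.medial.V 0).constr ℝ fun v =>
    Sum.elim (fun _ => 0) (fun e => edge (G.mid e) (G.old e.1.2)) (v 0 : G.V ⊕ G.Edge)

theorem secondHalf_old (a : G.V) : G.secondHalf (vert (G.old a)) = 0 := by
  rw [vert, secondHalf, Module.Basis.constr_basis]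
  rfl

theorem secondHalf_mid (e : G.Edge) :
    G.secondHalf (vert (G.mid e)) = edge (G.mid e) (G.old e.1.2) := by
  rw [vert, secondHalf, Module.Basis.constr_basis]
  rfl

/-- On chains the composite is the identity plus `secondHalf ∘ ∂`, as one checks on the two halves
of an edge. The error term vanishes on cycles. -/
theorem subdivide_edgeMap_retract {x : Elem G.medial.V 1} (hx : x ∈ G.medial.groundedCycles 0) :
    G.subdivide (edgeMap G.retract x) = x := by
  obtain ⟨hx1, hx2⟩ := G.medial.mem_groundedCycles_zero.1 hx
  have h : allowed G.medial.graph 1 ≤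
      LinearMap.ker (G.subdivide ∘ₗ edgeMap G.retract -
        (LinearMap.id + G.secondHalf ∘ₗ boundary G.medial.V 0)) := by
    refine G.allowed_medial_le (fun e => ?_) fun e => ?_
    · rw [LinearMap.mem_ker, LinearMap.sub_apply, LinearMap.comp_apply, edgeMap_edge,
        LinearMap.add_apply, LinearMap.comp_apply, boundary_edge, map_sub, secondHalf_old,
        secondHalf_mid, sub_zero, sub_eq_zero]
      exact G.subdivide_edge e
    · rw [LinearMap.mem_ker, LinearMap.sub_apply, LinearMap.comp_apply, edgeMap_edge,
        LinearMap.add_apply, LinearMap.comp_apply, boundary_edge, map_sub, secondHalf_old,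
        secondHalf_mid]
      change G.subdivide (edge e.1.2 e.1.2) - (edge (G.mid e) (G.old e.1.2) + _) = 0
      rw [edge_self, map_zero]
      abel
  have h' := sub_eq_zero.1 (LinearMap.mem_ker.1 (h hx1))
  rwa [LinearMap.add_apply, LinearMap.comp_apply, LinearMap.comp_apply, hx2, map_zero,
    add_zero] at h'

/-! ### Filtration shifts of subdivision and retraction. -/

theorem filtration_old {a b : G.V} {t : ℝ} (h : (G.filtration t).Adj a b) :
    G.old a = G.old b ∨ (G.medial.filtration t).Adj (G.old a) (G.old b) := by
  obtain ⟨p, hp⟩ := (G.dist_le_iff a b t).1 h.2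
  obtain ⟨q, hq⟩ := G.exists_trail_medial_inl p
  exact G.medial.eq_or_filtration_adj (a := G.old a) (b := G.old b) q (hq.trans_le hp)

theorem filtration_retract {c : ℝ} (hc0 : 0 ≤ c) (hc : ∀ e, G.weight e ≤ c) {x y : G.medial.V}
    {t : ℝ} (h : (G.medial.filtration t).Adj x y) :
    G.retract x = G.retract y ∨ (G.filtration (t + c)).Adj (G.retract x) (G.retract y) := by
  obtain ⟨p, hp⟩ := (G.medial.dist_le_iff x y t).1 h.2
  obtain ⟨q, hq⟩ := G.exists_trail_medialHead (x := x) (y := y) p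
  have h1 : ∀ x, 0 ≤ G.medialShift x := by
    rintro (a | e)
    · exact le_rfl
    · exact (half_pos (G.weight_pos e)).le
  have h2 : ∀ x, G.medialShift x ≤ c := by
    rintro (a | e)
    · exact hc0
    · have := hc e
      have := G.weight_pos e
      change G.weight e / 2 ≤ c
      linarith
  have hx := h1 x
  have hy := h2 y
  have hle : q.length ≤ p.length + c :=
    (le_add_of_nonneg_right hx).trans (hq.trans (add_le_add le_rfl hy))
  exact G.eq_or_filtration_adj q (hle.trans (add_le_add hp le_rfl))

/-- The inclusion of old vertices does not increase distances, so it carries a filling of `x` along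
without shift. The correction from old edges to their halves is bounded by `medialTri x`. -/
theorem subdivide_mem_groundedBoundaries {c : ℝ} (hc0 : 0 ≤ c) (hc : ∀ e, G.weight e ≤ c) {t : ℝ}
    (ht : 0 ≤ t) {x : Elem G.V 1} (hx0 : x ∈ G.groundedCycles 0)
    (hx : x ∈ G.groundedBoundaries t) :
    G.subdivide x ∈ G.medial.groundedBoundaries (t + c) := by
  rw [subdivide, LinearMap.add_apply, LinearMap.comp_apply]
  refine Submodule.add_mem _ ?_
    ((G.medial.mem_groundedBoundaries (add_nonneg ht hc0)).2 ⟨_, ?_, rfl⟩)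
  · obtain ⟨y, hy, rfl⟩ := (G.mem_groundedBoundaries ht).1 hx
    refine G.medial.groundedBoundaries_mono (le_add_of_nonneg_right hc0) ?_
    exact (G.medial.mem_groundedBoundaries ht).2
      ⟨_, triMap_mem_Omega (fun a b => G.filtration_old) hy, boundary_triMap _ _⟩
  -- The sides of the triangle `a v_e b` have distances at most `w(e) ≤ c`.
  · have h : allowed G.graph 1 ≤ (Omega (G.medial.filtration (t + c)) 2).comap G.medialTri := by
      refine G.allowed_graph_le fun e => ?_
      rw [Submodule.mem_comap, medialTri_edge]
      have hw := hc e
      have hw0 := G.weight_pos e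
      let p2 : G.medial.Trail (G.mid e) (G.old e.1.2) := .cons (G.adj_mid_old e) (.nil _)
      let p1 : G.medial.Trail (G.old e.1.1) (G.mid e) := .cons (G.adj_old_mid e) (.nil _)
      let p3 : G.medial.Trail (G.old e.1.1) (G.old e.1.2) := .cons (G.adj_old_mid e) p2
      have l1 : p1.length = G.weight e / 2 + 0 := rfl
      have l2 : p2.length = G.weight e / 2 + 0 := rfl
      have l3 : p3.length = G.weight e / 2 + (G.weight e / 2 + 0) := rfl
      exact tri_mem_Omega (G.medial.eq_or_filtration_adj p1 (by linarith))
        (G.medial.eq_or_filtration_adj p2 (by linarith))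
        (G.medial.eq_or_filtration_adj p3 (by linarith))
    exact h (G.mem_groundedCycles_zero.1 hx0).1

theorem edgeMap_retract_mem_groundedBoundaries {c : ℝ} (hc0 : 0 ≤ c) (hc : ∀ e, G.weight e ≤ c)
    {t : ℝ} (ht : 0 ≤ t) {x : Elem G.medial.V 1} (hx : x ∈ G.medial.groundedBoundaries t) :
    edgeMap G.retract x ∈ G.groundedBoundaries (t + c) := by
  obtain ⟨y, hy, rfl⟩ := (G.medial.mem_groundedBoundaries ht).1 hx
  exact (G.mem_groundedBoundaries (add_nonneg ht hc0)).2
    ⟨_, triMap_mem_Omega (fun a b => G.filtration_retract hc0 hc) hy, boundary_triMap _ _⟩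

/-! ### Comparison of homology dimensions before and after subdivision. -/

theorem finrank_groundedCycles_medial :
    Module.finrank ℝ (G.medial.groundedCycles 0) = Module.finrank ℝ (G.groundedCycles 0) :=
  le_antisymm
    (finrank_le_of_leftInverse _ _ (fun _ => G.edgeMap_retract_mem)
      fun _ => G.subdivide_edgeMap_retract)
    (finrank_le_of_leftInverse _ _ (fun _ => G.subdivide_mem)
      fun _ => G.edgeMap_retract_subdivide)

theorem finrank_groundedHomology_zero_medial :
    Module.finrank ℝ (G.medial.groundedHomology 0) = Module.finrank ℝ (G.groundedHomology 0) := by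
  have h1 := G.finrank_groundedHomology le_rfl
  have h2 := G.medial.finrank_groundedHomology le_rfl
  have h1' : G.groundedCycles 0 ⊓ G.groundedBoundaries 0 = ⊥ := by
    rw [groundedBoundaries_zero, inf_bot_eq]
  have h2' : G.medial.groundedCycles 0 ⊓ G.medial.groundedBoundaries 0 = ⊥ := by
    rw [groundedBoundaries_zero, inf_bot_eq]
  rw [h1', finrank_bot, add_zero] at h1
  rw [h2', finrank_bot, add_zero] at h2
  rw [h1, h2, finrank_groundedCycles_medial]

/-- The cycle spaces have equal dimension, and subdivision embeds the cycles bounding at `t` into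
those bounding at `t + c`. A larger space of bounding cycles means smaller homology. -/
theorem finrank_groundedHomology_medial_add_le {c : ℝ} (hc0 : 0 ≤ c) (hc : ∀ e, G.weight e ≤ c)
    {t : ℝ} (ht : 0 ≤ t) : Module.finrank ℝ (G.medial.groundedHomology (t + c)) ≤
      Module.finrank ℝ (G.groundedHomology t) := by
  have h1 := G.finrank_groundedHomology ht
  have h2 := G.medial.finrank_groundedHomology (add_nonneg ht hc0)
  have h3 := G.finrank_groundedCycles_medial
  have h4 : Module.finrank ℝ
        (G.groundedCycles 0 ⊓ G.groundedBoundaries t : Submodule ℝ (Elem G.V 1)) ≤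
      Module.finrank ℝ (G.medial.groundedCycles 0 ⊓ G.medial.groundedBoundaries (t + c) :
        Submodule ℝ (Elem G.medial.V 1)) :=
    finrank_le_of_leftInverse G.subdivide (edgeMap G.retract)
      (fun x hx => ⟨G.subdivide_mem hx.1, G.subdivide_mem_groundedBoundaries hc0 hc ht hx.1 hx.2⟩)
      fun x hx => G.edgeMap_retract_subdivide hx.1
  omega

theorem finrank_groundedHomology_add_le {c : ℝ} (hc0 : 0 ≤ c) (hc : ∀ e, G.weight e ≤ c)
    {t : ℝ} (ht : 0 ≤ t) : Module.finrank ℝ (G.groundedHomology (t + c)) ≤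
      Module.finrank ℝ (G.medial.groundedHomology t) := by
  have h1 := G.finrank_groundedHomology (add_nonneg ht hc0)
  have h2 := G.medial.finrank_groundedHomology ht
  have h3 := G.finrank_groundedCycles_medial
  have h4 : Module.finrank ℝ (G.medial.groundedCycles 0 ⊓ G.medial.groundedBoundaries t :
        Submodule ℝ (Elem G.medial.V 1)) ≤
      Module.finrank ℝ
        (G.groundedCycles 0 ⊓ G.groundedBoundaries (t + c) : Submodule ℝ (Elem G.V 1)) :=
    finrank_le_of_leftInverse (edgeMap G.retract) G.subdivide
      (fun x hx => ⟨G.edgeMap_retract_mem hx.1,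
        G.edgeMap_retract_mem_groundedBoundaries hc0 hc ht hx.2⟩)
      fun x hx => G.subdivide_edgeMap_retract hx.1
  omega

theorem exists_weight_le : ∃ c : ℝ, 0 ≤ c ∧ ∀ e, G.weight e ≤ c := by
  obtain ⟨c, hc⟩ := (Set.finite_range G.weight).bddAbove
  exact ⟨max 0 c, le_max_left _ _, fun e => (hc ⟨e, rfl⟩).trans (le_max_right _ _)⟩

theorem medial_weight_le {c : ℝ} (hc : ∀ e, G.weight e ≤ c) (e : G.medial.Edge) :
    G.medial.weight e ≤ c / 2 := by
  obtain ⟨⟨a | e, b | e'⟩, h⟩ := e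
  · exact (h : False).elim
  · exact div_le_div_of_nonneg_right (hc e') zero_le_two
  · exact div_le_div_of_nonneg_right (hc e) zero_le_two
  · exact (h : False).elim

theorem iteratedMedial_weight_le (G : WDigraph) {c : ℝ} (hc : ∀ e, G.weight e ≤ c) :
    ∀ (n : ℕ) (e : (G.iteratedMedial n).Edge), (G.iteratedMedial n).weight e ≤ c / 2 ^ n
  | 0, e => by
    rw [pow_zero, div_one]
    exact hc e
  | n + 1, e => by
    rw [pow_succ, ← div_div]
    exact (G.iteratedMedial n).medial_weight_le (G.iteratedMedial_weight_le hc n) e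

end WDigraph

/-! ## Bases adapted to a chain of subspaces -/

/-- A basis of each subspace is extended to a basis of the next one. -/
theorem exists_linearIndepOn_forall_span_inter {E : Type} [AddCommGroup E] [Module ℝ E]
    (U : ℕ → Submodule ℝ E) (hU : Monotone U) (n : ℕ) :
    ∃ S : Set E, LinearIndepOn ℝ id S ∧ S ⊆ U n ∧
      ∀ k ≤ n, Submodule.span ℝ (S ∩ U k) = U k := by
  have key : ∀ (S₀ : Set E) (n : ℕ), LinearIndepOn ℝ id S₀ → S₀ ⊆ U n →
      (∀ k < n, Submodule.span ℝ (S₀ ∩ U k) = U k) →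
      ∃ S : Set E, LinearIndepOn ℝ id S ∧ S ⊆ U n ∧
        ∀ k ≤ n, Submodule.span ℝ (S ∩ U k) = U k := by
    intro S₀ n hli hS₀ hspan
    obtain ⟨S, hSU, hS₀S, hUS, hS⟩ := exists_linearIndepOn_id_extension hli hS₀
    refine ⟨S, hS, hSU, fun k hk => le_antisymm (Submodule.span_le.2 Set.inter_subset_right) ?_⟩
    rcases hk.lt_or_eq with hk | rfl
    · rw [← hspan k hk]
      exact Submodule.span_mono (by
        rw [hspan k hk]
        exact Set.inter_subset_inter_left _ hS₀S)
    · rwa [Set.inter_eq_left.2 hSU]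
  induction n with
  | zero => exact key ∅ 0 (linearIndepOn_empty ℝ id) (Set.empty_subset _) (by simp)
  | succ n ih =>
    obtain ⟨S, h1, h2, h3⟩ := ih
    exact key S (n + 1) h1 (h2.trans (hU n.le_succ)) fun k hk => h3 k (Nat.lt_succ_iff.1 hk)

/-- Members of a chain with equal dimension coincide, so the chain can be reindexed by dimension and
becomes a sequence. -/
theorem exists_adapted_basis {E T : Type} [AddCommGroup E] [Module ℝ E] [Module.Finite ℝ E]
    [LinearOrder T] (K : T → Submodule ℝ E) (hK : Monotone K) :
    ∃ S : Set E, LinearIndepOn ℝ id S ∧ Submodule.span ℝ S = ⊤ ∧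
      ∀ t, Submodule.span ℝ (S ∩ K t) = K t := by
  -- The value `⊤` above the dimension of `E` forces the adapted set to span `E`, even if no `K t`
  -- is all of `E`.
  let U : ℕ → Submodule ℝ E := fun k =>
    if Module.finrank ℝ E < k then ⊤ else ⨆ (t) (_ : Module.finrank ℝ (K t) ≤ k), K t
  have hU : Monotone U := by
    intro k l hkl
    by_cases hl : Module.finrank ℝ E < l
    · simp [U, hl]
    · have hk : ¬ Module.finrank ℝ E < k := fun h => hl (h.trans_le hkl)
      simp only [U, hl, hk, if_false]
      exact iSup₂_le fun t ht => le_iSup₂_of_le t (ht.trans hkl) le_rfl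
  have hKU : ∀ t, U (Module.finrank ℝ (K t)) = K t := by
    intro t
    simp only [U, (Submodule.finrank_le (K t)).not_gt, if_false]
    refine le_antisymm (iSup₂_le fun s hs => ?_) (le_iSup₂_of_le t le_rfl le_rfl)
    rcases le_total s t with h | h
    · exact hK h
    · exact (Submodule.eq_of_le_of_finrank_le (hK h) hs).ge
  obtain ⟨S, h1, -, h3⟩ :=
    exists_linearIndepOn_forall_span_inter U hU (Module.finrank ℝ E + 1)
  refine ⟨S, h1, ?_, fun t => ?_⟩
  · have := h3 _ le_rfl
    have hU' : U (Module.finrank ℝ E + 1) = ⊤ := by simp [U]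
    rwa [hU', Submodule.top_coe, Set.inter_univ] at this
  · have := h3 (Module.finrank ℝ (K t)) ((Submodule.finrank_le _).trans (Nat.le_succ _))
    rwa [hKU] at this

/-! ## Persistent vector spaces that are quotients of their value at `0` -/

/-- The persistent vector space `M` vanishes at negative parameters, is finite-dimensional at `0`,
and each `M 0 → M t` is surjective. -/
structure IsGrounded (M : PersVec) : Prop where
  subsingleton : ∀ t < 0, Subsingleton (M.obj t)
  finite : Module.Finite ℝ (M.obj 0)
  surjective : ∀ t (h : 0 ≤ t), Function.Surjective (M.map (homOfLE h)).hom

theorem WDigraph.isGrounded_grpph (G : WDigraph) : IsGrounded G.grpph where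
  subsingleton _ ht := G.subsingleton_groundedHomology ht
  finite := inferInstanceAs (Module.Finite ℝ (G.groundedHomology 0))
  surjective _ ht := G.groundedHomologyMap_surjective ht

theorem map_map_apply (M : PersVec) {r s t : ℝ} (f : r ⟶ s) (g : s ⟶ t) (h : r ⟶ t)
    (x : M.obj r) : (M.map g).hom ((M.map f).hom x) = (M.map h).hom x := by
  rw [Subsingleton.elim h (f ≫ g), M.map_comp]
  rfl

theorem map_self_apply (M : PersVec) {t : ℝ} (f : t ⟶ t) (x : M.obj t) :
    (M.map f).hom x = x := by
  rw [Subsingleton.elim f (𝟙 t), M.map_id]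
  rfl

theorem IsGrounded.of_iso {M N : PersVec} (hM : IsGrounded M) (e : M ≅ N) : IsGrounded N where
  subsingleton t ht :=
    have := hM.subsingleton t ht
    (e.app t).toLinearEquiv.symm.injective.subsingleton
  finite :=
    have := hM.finite
    Module.Finite.equiv (e.app 0).toLinearEquiv
  surjective t ht y := by
    obtain ⟨x, hx⟩ := hM.surjective t ht ((e.app t).toLinearEquiv.symm y)
    refine ⟨(e.app 0).toLinearEquiv x, ?_⟩
    have h := congrArg (fun φ => φ.hom x) (e.hom.naturality (homOfLE ht))
    refine h.symm.trans ?_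
    change (e.app t).toLinearEquiv ((M.map (homOfLE ht)).hom x) = y
    rw [hx, LinearEquiv.apply_symm_apply]

/-! ### Sums of interval modules -/

theorem finrank_fiber (I : RealInterval) (t : ℝ) [Decidable (t ∈ I.carrier)] :
    Module.finrank ℝ (I.fiber t) = if t ∈ I.carrier then 1 else 0 := by
  by_cases h : t ∈ I.carrier
  · rw [RealInterval.fiber, if_pos h, if_pos h, finrank_top, Module.finrank_self]
  · rw [RealInterval.fiber, if_neg h, if_neg h, finrank_bot]

/-- The generator of an interval module at a parameter in the interval. -/
def RealInterval.one (I : RealInterval) {t : ℝ} (h : t ∈ I.carrier) : I.fiber t :=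
  ⟨1, by simp [RealInterval.fiber, h]⟩

theorem RealInterval.one_ne_zero (I : RealInterval) {t : ℝ} (h : t ∈ I.carrier) : I.one h ≠ 0 :=
  fun h' => _root_.one_ne_zero (congrArg Subtype.val h' : (1 : ℝ) = 0)

/-- The value at `t` of the sum of the interval modules of a barcode. -/
abbrev Barcode.sum (B : Barcode) (t : ℝ) : Type := ⨁ i, (B.bar i).fiber t

open Classical in
/-- The inclusion of a summand. -/
def Barcode.single (B : Barcode) {t : ℝ} (i : B.ι) : (B.bar i).fiber t →ₗ[ℝ] B.sum t :=
  DirectSum.lof ℝ B.ι (fun i => (B.bar i).fiber t) i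

/-- The projection to a summand. -/
def Barcode.coord (B : Barcode) {t : ℝ} (i : B.ι) : B.sum t →ₗ[ℝ] (B.bar i).fiber t :=
  DirectSum.component ℝ B.ι (fun i => (B.bar i).fiber t) i

theorem Barcode.coord_single_self (B : Barcode) {t : ℝ} (i : B.ι) (x : (B.bar i).fiber t) :
    B.coord i (B.single i x) = x := by
  classical
  exact DirectSum.component.lof_self _ _ _

theorem Barcode.coord_single_of_ne (B : Barcode) {t : ℝ} {i j : B.ι} (h : i ≠ j)
    (x : (B.bar i).fiber t) : B.coord j (B.single i x) = 0 := by
  classical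
  exact DirectSum.of_eq_of_ne _ _ _ h.symm

/-- The structure maps of the sum of the interval modules of a barcode. -/
def Barcode.sumMap (B : Barcode) (s t : ℝ) : B.sum s →ₗ[ℝ] B.sum t :=
  DirectSum.lmap fun i => (B.bar i).fiberMap s t

theorem Barcode.coord_sumMap (B : Barcode) {s t : ℝ} (i : B.ι) (x : B.sum s) :
    B.coord i (B.sumMap s t x) = (B.bar i).fiberMap s t (B.coord i x) :=
  rfl

theorem Barcode.sumMap_single (B : Barcode) {s t : ℝ} (i : B.ι) (x : (B.bar i).fiber s) :
    B.sumMap s t (B.single i x) = B.single i ((B.bar i).fiberMap s t x) := by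
  classical
  exact DirectSum.lmap_lof _ _ _

theorem Barcode.linearIndependent (B : Barcode) {t : ℝ} (h : ∀ i, t ∈ (B.bar i).carrier) :
    LinearIndependent ℝ fun i : B.ι => B.single i ((B.bar i).one (h i)) := by
  refine linearIndependent_iff'.2 fun s g hg j hj => ?_
  have h1 := congrArg (B.coord j) hg
  rw [map_sum, Finset.sum_eq_single j, map_smul, B.coord_single_self, map_zero] at h1
  · exact (smul_eq_zero.1 h1).resolve_right ((B.bar j).one_ne_zero (h j))
  · intro i _ hij
    rw [map_smul, B.coord_single_of_ne hij, smul_zero]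
  · exact fun h' => (h' hj).elim

theorem Barcode.finrank_sum (B : Barcode) [Finite B.ι] (t : ℝ) :
    Module.finrank ℝ (B.sum t) = Nat.card {i // t ∈ (B.bar i).carrier} := by
  classical
  have := Fintype.ofFinite B.ι
  rw [Module.finrank_directSum, Nat.card_eq_fintype_card, Fintype.card_subtype]
  simp only [finrank_fiber, Finset.sum_boole, Nat.cast_id]

theorem IsBarcodeOf.nonneg {B : Barcode} {M : PersVec} (hM : IsGrounded M)
    (hB : IsBarcodeOf B M) {i : B.ι} {t : ℝ} (h : t ∈ (B.bar i).carrier) : 0 ≤ t := by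
  obtain ⟨e⟩ := hB
  by_contra ht
  have : Subsingleton (B.sum t) := (hM.of_iso e).subsingleton t (not_le.1 ht)
  refine (B.bar i).one_ne_zero h ?_
  rw [← B.coord_single_self i ((B.bar i).one h), this.elim (B.single i _) 0, map_zero]

/-- The generator of a bar that misses `0` would not be in the image of the value at `0`. -/
theorem IsBarcodeOf.zero_mem {B : Barcode} {M : PersVec} (hM : IsGrounded M)
    (hB : IsBarcodeOf B M) (i : B.ι) : (0 : ℝ) ∈ (B.bar i).carrier := by
  obtain ⟨t, h⟩ := (B.bar i).nonempty
  have ht := hB.nonneg hM h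
  obtain ⟨e⟩ := hB
  by_contra h0
  have hsurj : Function.Surjective (B.sumMap 0 t) := (hM.of_iso e).surjective t ht
  obtain ⟨x, hx⟩ := hsurj (B.single i ((B.bar i).one h))
  have h1 := congrArg (B.coord i) hx
  have h2 : B.coord i x = 0 := Subtype.ext ((B.bar i).fiber_eq_zero h0 _)
  rw [B.coord_single_self, B.coord_sumMap, h2, map_zero] at h1
  exact (B.bar i).one_ne_zero h h1.symm

theorem IsBarcodeOf.finite {B : Barcode} {M : PersVec} (hM : IsGrounded M)
    (hB : IsBarcodeOf B M) : Finite B.ι := by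
  have h := B.linearIndependent (t := 0) (hB.zero_mem hM)
  obtain ⟨e⟩ := hB
  have : Module.Finite ℝ (B.sum 0) := (hM.of_iso e).finite
  exact h.finite

/-- The link from dimensions to bars: death times are compared only through these counts. -/
theorem IsBarcodeOf.card_eq_finrank {B : Barcode} {M : PersVec} (hM : IsGrounded M)
    (hB : IsBarcodeOf B M) (t : ℝ) :
    Nat.card {i // t ∈ (B.bar i).carrier} = Module.finrank ℝ (M.obj t) := by
  have := hB.finite hM
  obtain ⟨e⟩ := hB
  exact (B.finrank_sum t).symm.trans (e.app t).toLinearEquiv.finrank_eq.symm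

/-! ### Existence of barcodes -/

section

variable {M : PersVec}

/-- The image of an element of `M 0` in `M t`; it is `0` for `t < 0`. -/
def orbit (M : PersVec) (x : M.obj 0) (t : ℝ) : M.obj t :=
  if h : 0 ≤ t then (M.map (homOfLE h)).hom x else 0

theorem orbit_of_nonneg (x : M.obj 0) {t : ℝ} (h : 0 ≤ t) :
    orbit M x t = (M.map (homOfLE h)).hom x := dif_pos h

theorem nonneg_of_orbit_ne_zero {x : M.obj 0} {t : ℝ} (h : orbit M x t ≠ 0) : 0 ≤ t := by
  by_contra ht
  exact h (dif_neg ht)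

theorem map_orbit (x : M.obj 0) {s t : ℝ} (hs : 0 ≤ s) (f : s ⟶ t) :
    (M.map f).hom (orbit M x s) = orbit M x t := by
  rw [orbit_of_nonneg x hs, orbit_of_nonneg x (hs.trans (leOfHom f)), map_map_apply]

/-- The interval of parameters at which the image of `x` does not vanish. -/
def lifespan (M : PersVec) (x : M.obj 0) (hx : x ≠ 0) : RealInterval where
  carrier := {t | orbit M x t ≠ 0}
  nonempty := ⟨0, by
    rw [Set.mem_ofPred_eq, orbit_of_nonneg x le_rfl, map_self_apply]
    exact hx⟩
  ordConnected := by
    refine ⟨fun s hs t ht u hu h => ht ?_⟩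
    rw [← map_orbit x ((nonneg_of_orbit_ne_zero hs).trans hu.1) (homOfLE hu.2), h, map_zero]

/-- The barcode of the lifespans of a family of elements of `M 0`. -/
abbrev lifespans {ι : Type} (b : ι → M.obj 0) (hb : ∀ i, b i ≠ 0) : Barcode :=
  ⟨ι, fun i => lifespan M (b i) (hb i)⟩

variable {ι : Type} (b : ι → M.obj 0) (hb : ∀ i, b i ≠ 0)

open Classical in
/-- The map from the sum of the interval modules of the lifespans to `M`. -/
def orbitMap (t : ℝ) : (lifespans b hb).sum t →ₗ[ℝ] M.obj t :=
  DirectSum.toModule ℝ ι (M.obj t) fun i =>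
    LinearMap.toSpanSingleton ℝ (M.obj t) (orbit M (b i) t) ∘ₗ
      ((lifespan M (b i) (hb i)).fiber t).subtype

theorem orbitMap_single (t : ℝ) (i : ι) (x : (lifespan M (b i) (hb i)).fiber t) :
    orbitMap b hb t ((lifespans b hb).single i x) = (x : ℝ) • orbit M (b i) t := by
  classical
  exact DirectSum.toModule_lof _ _ _

theorem Barcode.linearMap_ext (B : Barcode) {t : ℝ} {N : Type} [AddCommGroup N] [Module ℝ N]
    {f g : B.sum t →ₗ[ℝ] N} (h : ∀ i x, f (B.single i x) = g (B.single i x)) : f = g := by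
  classical
  exact DirectSum.linearMap_ext ℝ fun i => LinearMap.ext fun x => h i x

theorem map_comp_orbitMap {s t : ℝ} (f : s ⟶ t) :
    orbitMap b hb t ∘ₗ (lifespans b hb).sumMap s t = (M.map f).hom ∘ₗ orbitMap b hb s := by
  refine Barcode.linearMap_ext _ fun (i : ι) (x : (lifespan M (b i) (hb i)).fiber s) => ?_
  let I := lifespan M (b i) (hb i)
  have h1 := (congrArg (orbitMap b hb t)
    ((lifespans b hb).sumMap_single (t := t) i x)).trans (orbitMap_single b hb t i _)
  have h2 := (congrArg (M.map f).hom (orbitMap_single b hb s i x)).trans (map_smul _ _ _)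
  refine h1.trans (Eq.trans ?_ h2.symm)
  change ((I.fiberMap s t x : I.fiber t) : ℝ) • orbit M (b i) t =
    (x : ℝ) • (M.map f).hom (orbit M (b i) s)
  by_cases hs : s ∈ I.carrier
  · rw [map_orbit (b i) (nonneg_of_orbit_ne_zero hs) f]
    by_cases ht : t ∈ I.carrier
    · rw [I.coe_fiberMap ht]
    · rw [not_not.1 ht, smul_zero, smul_zero]
  · have hx : x = 0 := Subtype.ext (I.fiber_eq_zero hs x)
    rw [hx, map_zero, ZeroMemClass.coe_zero, ZeroMemClass.coe_zero, zero_smul, zero_smul]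

/-- The morphism from the sum of the interval modules of the lifespans to `M`. -/
def orbitHom : directSum (fun i => ((lifespans b hb).bar i).module) ⟶ M where
  app t := ModuleCat.ofHom (orbitMap b hb t)
  naturality _ _ f := ModuleCat.hom_ext (map_comp_orbitMap b hb f)

theorem orbitMap_surjective (hM : IsGrounded M) (htop : Submodule.span ℝ (Set.range b) = ⊤) {t : ℝ}
    (ht : 0 ≤ t) : Function.Surjective (orbitMap b hb t) := by
  rw [← LinearMap.range_eq_top, eq_top_iff, ← LinearMap.range_eq_top.2 (hM.surjective t ht),
    LinearMap.range_eq_map, ← htop, Submodule.map_span_le]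
  rintro _ ⟨i, rfl⟩
  rw [← orbit_of_nonneg (b i) ht]
  by_cases h0 : orbit M (b i) t = 0
  · rw [h0]
    exact Submodule.zero_mem _
  · refine ⟨(lifespans b hb).single i (RealInterval.one (lifespan M (b i) (hb i)) h0), ?_⟩
    rw [orbitMap_single]
    exact one_smul ℝ _

end

/-- The kernels of `M 0 → M t` form a chain. The members of an adapted basis outside the kernel at
`t` map to a basis of `M t`, so the lifespans of the basis elements are the bars. -/
theorem IsGrounded.exists_isBarcodeOf {M : PersVec} (hM : IsGrounded M) :
    ∃ B : Barcode, IsBarcodeOf B M := by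
  classical
  have hfin := hM.finite
  let K : {t : ℝ // 0 ≤ t} → Submodule ℝ (M.obj 0) := fun t =>
    LinearMap.ker (M.map (homOfLE t.2)).hom
  have hK : Monotone K := by
    intro s t hst x hx
    rw [LinearMap.mem_ker] at hx ⊢
    rw [← map_map_apply M (homOfLE s.2) (homOfLE (show s.1 ≤ t.1 from hst)), hx, map_zero]
  obtain ⟨S, hli, htop, hS⟩ := exists_adapted_basis K hK
  let b : S → M.obj 0 := fun x => x
  have hne : ∀ x, b x ≠ 0 := fun x => LinearIndependent.ne_zero x hli
  have hSfin : Finite S := LinearIndependent.finite hli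
  have hSft := Fintype.ofFinite S
  let B : Barcode := lifespans b hne
  have hBfin : Finite B.ι := hSfin
  have hcard : Module.finrank ℝ (M.obj 0) = Fintype.card S := by
    rw [← finrank_top, ← htop, finrank_span_set_eq_card hli, Set.toFinset_card]
  have hbij : ∀ t, Function.Bijective (orbitMap b hne t) := by
    intro t
    by_cases ht : 0 ≤ t
    · let π : M.obj 0 →ₗ[ℝ] M.obj t := (M.map (homOfLE ht)).hom
      have hπ : Function.Surjective π := hM.surjective t ht
      have : Module.Finite ℝ (M.obj t) := Module.Finite.of_surjective π hπ
      have hsurj := orbitMap_surjective b hne hM (by rwa [Subtype.range_coe]) ht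
      -- By adaptedness the basis elements that are dead at `t` form a basis of the kernel, so the
      -- living ones number `dim M t`. Surjectivity then gives bijectivity.
      have hdim : Module.finrank ℝ (B.sum t) = Module.finrank ℝ (M.obj t) := by
        have h1 := π.finrank_range_add_finrank_ker
        have h2 : Module.finrank ℝ (LinearMap.ker π) =
            Fintype.card {x : S // ¬ orbit M (b x) t ≠ 0} := by
          have hmem : ∀ x : S, ¬ orbit M (b x) t ≠ 0 ↔ (x : M.obj 0) ∈ K ⟨t, ht⟩ := by
            intro x
            rw [not_not, orbit_of_nonneg _ ht]
            rfl
          have hli' : LinearIndependent ℝ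
              fun x : {x : S // ¬ orbit M (b x) t ≠ 0} => (x.1 : M.obj 0) :=
            LinearIndependent.comp hli _ Subtype.val_injective
          rw [← finrank_span_eq_card hli']
          change Module.finrank ℝ (K ⟨t, ht⟩) = _
          rw [← hS ⟨t, ht⟩]
          have hset : S ∩ K ⟨t, ht⟩ =
              Set.range fun x : {x : S // ¬ orbit M (b x) t ≠ 0} => (x.1 : M.obj 0) := by
            ext y
            constructor
            · rintro ⟨hy, hy'⟩
              exact ⟨⟨⟨y, hy⟩, (hmem ⟨y, hy⟩).2 hy'⟩, rfl⟩
            · rintro ⟨x, rfl⟩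
              exact ⟨x.1.2, (hmem x.1).1 x.2⟩
          rw [hset]
        have h3 : Module.finrank ℝ (B.sum t) = Fintype.card {x : S // orbit M (b x) t ≠ 0} :=
          (B.finrank_sum t).trans (Nat.card_eq_fintype_card (α := {x : S // orbit M (b x) t ≠ 0}))
        have h4 := Fintype.card_subtype_compl fun x : S => orbit M (b x) t ≠ 0
        have h5 := Fintype.card_subtype_le fun x : S => orbit M (b x) t ≠ 0
        rw [LinearMap.range_eq_top.2 hπ, finrank_top, h2, hcard] at h1
        omega
      have : Module.Finite ℝ (B.sum t) :=
        have := Fintype.ofFinite B.ι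
        inferInstanceAs (Module.Finite ℝ (⨁ i, (B.bar i).fiber t))
      exact ⟨(LinearMap.injective_iff_surjective_of_finrank_eq_finrank hdim).2 hsurj, hsurj⟩
    · have h1 := hM.subsingleton t (not_le.1 ht)
      have h2 : Subsingleton (B.sum t) := by
        refine ⟨fun x y => DFinsupp.ext fun i => Subtype.ext ?_⟩
        have hi : t ∉ (B.bar i).carrier := fun h => ht (nonneg_of_orbit_ne_zero h)
        rw [(B.bar i).fiber_eq_zero hi, (B.bar i).fiber_eq_zero hi]
      exact ⟨fun x y _ => h2.elim x y, fun y => ⟨0, h1.elim _ _⟩⟩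
  have hiso : ∀ t, IsIso ((orbitHom b hne).app t) := fun t =>
    (ConcreteCategory.isIso_iff_bijective _).2 (hbij t)
  have := NatIso.isIso_of_isIso_app (orbitHom b hne)
  exact ⟨B, ⟨(asIso (orbitHom b hne)).symm⟩⟩

/-! ## Sorted death times -/

/-- The right endpoint of an interval. -/
def RealInterval.death (I : RealInterval) : EReal := I.endpoints.2

theorem RealInterval.coe_le_death {I : RealInterval} {t : ℝ} (h : t ∈ I.carrier) :
    (t : EReal) ≤ I.death := le_sSup ⟨t, h, rfl⟩

theorem RealInterval.mem_of_lt_death {I : RealInterval} (h0 : (0 : ℝ) ∈ I.carrier) {t : ℝ}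
    (ht : 0 ≤ t) (h : (t : EReal) < I.death) : t ∈ I.carrier := by
  obtain ⟨_, ⟨s, hs, rfl⟩, hts⟩ := lt_sSup_iff.1 h
  exact I.ordConnected.out h0 hs ⟨ht, (EReal.coe_lt_coe_iff.1 hts).le⟩

theorem RealInterval.endpoints_eq {I : RealInterval} (h0 : (0 : ℝ) ∈ I.carrier)
    (h : ∀ t ∈ I.carrier, 0 ≤ t) : I.endpoints = (0, I.death) := by
  refine Prod.ext (le_antisymm (sInf_le ⟨0, h0, rfl⟩) (le_sInf ?_)) rfl
  rintro _ ⟨t, ht, rfl⟩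
  exact EReal.coe_le_coe_iff.2 (h t ht)

theorem exists_equiv_monotone {ι : Type} [Finite ι] {m : ℕ} (hm : Nat.card ι = m) (f : ι → EReal) :
    ∃ e : Fin m ≃ ι, Monotone fun k => f (e k) := by
  subst hm
  let e := (Finite.equivFin ι).symm
  exact ⟨(Tuple.sort (f ∘ e)).trans e, Tuple.monotone_sort (f ∘ e)⟩

theorem IsBarcodeOf.exists_sorted {B : Barcode} {M : PersVec} (hM : IsGrounded M)
    (hB : IsBarcodeOf B M) {m : ℕ} (hm : Module.finrank ℝ (M.obj 0) = m) :
    ∃ e : Fin m ≃ B.ι, Monotone fun k => (B.bar (e k)).death := by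
  have := hB.finite hM
  refine exists_equiv_monotone ?_ fun i => (B.bar i).death
  rw [← hm, ← hB.card_eq_finrank hM 0]
  exact Nat.card_congr (Equiv.subtypeUnivEquiv (hB.zero_mem hM)).symm

/-- Otherwise some `t` exceeds the `k`-th death of `B` while `t + ε` is below that of `B'`. Counting
indices from `0`, at most `m - 1 - k` bars of `B` contain `t`, but at least `m - k` bars of `B'`
contain `t + ε`, against `h`. -/
theorem IsBarcodeOf.death_le_add {B B' : Barcode} {M M' : PersVec} (hM : IsGrounded M)
    (hM' : IsGrounded M') (hB : IsBarcodeOf B M) (hB' : IsBarcodeOf B' M') {m : ℕ}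
    {e : Fin m ≃ B.ι} (he : Monotone fun k => (B.bar (e k)).death)
    {e' : Fin m ≃ B'.ι} (he' : Monotone fun k => (B'.bar (e' k)).death) {ε : ℝ} (hε : 0 ≤ ε)
    (h : ∀ t : ℝ, 0 ≤ t → Module.finrank ℝ (M'.obj (t + ε)) ≤ Module.finrank ℝ (M.obj t))
    (k : Fin m) : (B'.bar (e' k)).death ≤ (B.bar (e k)).death + (ε : EReal) := by
  classical
  by_contra! hk
  -- Both inequalities are strict, so it does not matter whether bars contain their right endpoints.
  obtain ⟨s, hs, hs'⟩ := EReal.lt_iff_exists_real_btwn.1 hk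
  obtain ⟨t, rfl⟩ : ∃ t, s = t + ε := ⟨s - ε, by ring⟩
  have hd : (B.bar (e k)).death < (t : EReal) := by
    by_contra! hd
    refine hs.not_ge ?_
    rw [EReal.coe_add]
    exact add_le_add hd le_rfl
  have ht : 0 ≤ t := by
    have := (RealInterval.coe_le_death (hB.zero_mem hM (e k))).trans_lt hd
    exact (EReal.coe_lt_coe_iff.1 this).le
  have h1 : Nat.card {i // t ∈ (B.bar i).carrier} ≤ (Finset.Ioi k).card := by
    rw [← Nat.card_congr (e.subtypeEquiv (p := fun j => t ∈ (B.bar (e j)).carrier)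
      fun _ => Iff.rfl), Nat.card_eq_fintype_card, Fintype.card_subtype]
    refine Finset.card_le_card fun j hj => Finset.mem_Ioi.2 ?_
    by_contra! hjk
    exact ((RealInterval.coe_le_death (Finset.mem_filter.1 hj).2).trans (he hjk)).not_gt hd
  have h2 : (Finset.Ici k).card ≤ Nat.card {i // t + ε ∈ (B'.bar i).carrier} := by
    rw [← Nat.card_congr (e'.subtypeEquiv (p := fun j => t + ε ∈ (B'.bar (e' j)).carrier)
      fun _ => Iff.rfl), Nat.card_eq_fintype_card, Fintype.card_subtype]
    refine Finset.card_le_card fun j hj => Finset.mem_filter.2 ⟨Finset.mem_univ _, ?_⟩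
    exact RealInterval.mem_of_lt_death (hB'.zero_mem hM' _) (add_nonneg ht hε)
      (hs'.trans_le (he' (Finset.mem_Ici.1 hj)))
  have h3 := h t ht
  rw [hB.card_eq_finrank hM] at h1
  rw [hB'.card_eq_finrank hM'] at h2
  rw [Fin.card_Ioi] at h1
  rw [Fin.card_Ici] at h2
  have := k.2
  omega

/-! ## Convergence -/

theorem coordDist_coe (x y : ℝ) : coordDist (x : EReal) (y : EReal) ≤ ENNReal.ofReal |x - y| := by
  unfold coordDist
  split_ifs
  · exact zero_le
  · rw [← EReal.coe_sub, EReal.abs_def]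

theorem exists_limit_of_geometric {d : ℕ → EReal} (h0 : ∀ n, 0 ≤ d n) {C : ℝ}
    (h1 : ∀ n, d (n + 1) ≤ d n + ((C / 2 ^ n : ℝ) : EReal))
    (h2 : ∀ n, d n ≤ d (n + 1) + ((C / 2 ^ n : ℝ) : EReal)) :
    ∃ D : EReal, 0 ≤ D ∧ ∀ n, coordDist (d n) D ≤ ENNReal.ofReal (2 * C / 2 ^ n) := by
  by_cases htop : d 0 = ⊤
  -- Finite shifts cannot make an infinite death finite, nor the converse.
  · have hd : ∀ n, d n = ⊤ := by
      intro n
      induction n with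
      | zero => exact htop
      | succ n ih =>
        by_contra h
        have := h2 n
        rw [ih] at this
        exact (EReal.add_lt_top h (EReal.coe_ne_top _)).not_ge this
    exact ⟨⊤, le_top, fun n => by rw [hd n, coordDist, if_pos rfl]; exact zero_le⟩
  · have hd : ∀ n, d n ≠ ⊤ := by
      intro n
      induction n with
      | zero => exact htop
      | succ n ih => exact ((h1 n).trans_lt (EReal.add_lt_top ih (EReal.coe_ne_top _))).ne
    have hbot : ∀ n, d n ≠ ⊥ := fun n => (EReal.bot_lt_zero.trans_le (h0 n)).ne'
    lift d to ℕ → ℝ using fun n => ⟨hd n, hbot n⟩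
    -- The bound `C / 2 ^ n` in the form of a geometric series whose tail from `n` on is `2 * C / 2
    -- ^ n`.
    have hdist : ∀ n, dist (d n) (d (n + 1)) ≤ 2 * C / 2 / 2 ^ n := by
      intro n
      have h1' := h1 n
      have h2' := h2 n
      rw [← EReal.coe_add, EReal.coe_le_coe_iff] at h1' h2'
      rw [mul_div_cancel_left₀ C two_ne_zero, Real.dist_eq, abs_le]
      constructor <;> linarith
    obtain ⟨D, hD⟩ := cauchySeq_tendsto_of_complete (cauchySeq_of_le_geometric_two hdist)
    refine ⟨D, EReal.coe_nonneg.2 (ge_of_tendsto' hD fun n => EReal.coe_nonneg.1 (h0 n)),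
      fun n => (coordDist_coe _ _).trans (ENNReal.ofReal_le_ofReal ?_)⟩
    exact dist_le_of_le_geometric_two_of_tendsto hdist hD n

/-- The interval of the nonnegative reals that are at most `D`. -/
def RealInterval.upTo (D : EReal) (hD : 0 ≤ D) : RealInterval where
  carrier := {t | 0 ≤ t ∧ (t : EReal) ≤ D}
  nonempty := ⟨0, le_rfl, hD⟩
  ordConnected := ⟨fun _ hs _ ht _ hu =>
    ⟨hs.1.trans hu.1, (EReal.coe_le_coe_iff.2 hu.2).trans ht.2⟩⟩

/-- The closed right end keeps the bar nonempty for `D = 0`, where its endpoints lie on the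
diagonal; for `D = ⊤` it is the half-line. -/
theorem RealInterval.endpoints_upTo (D : EReal) (hD : 0 ≤ D) :
    (upTo D hD).endpoints = (0, D) := by
  rw [endpoints_eq (I := upTo D hD) ⟨le_rfl, hD⟩ fun t ht => ht.1]
  refine Prod.ext rfl (le_antisymm (sSup_le ?_) (le_of_forall_lt fun c hc => ?_))
  · rintro _ ⟨t, ht, rfl⟩
    exact ht.2
  · rcases lt_or_ge c 0 with h | h
    · exact h.trans_le (coe_le_death (I := upTo D hD) ⟨le_rfl, hD⟩)
    · obtain ⟨t, hct, htD⟩ := EReal.lt_iff_exists_real_btwn.1 hc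
      exact hct.trans_le (coe_le_death (I := upTo D hD)
        ⟨EReal.coe_nonneg.1 (h.trans hct.le), htD.le⟩)

theorem coordDist_self (x : EReal) : coordDist x x = 0 := if_pos rfl

/-- The matching fixes every diagonal point, at no cost. -/
theorem bottleneckDist_le {B B' : Barcode} (e : B.ι ≃ B'.ι) {r : ℝ≥0∞}
    (h : ∀ i, planeDist (B.bar i).endpoints (B'.bar (e i)).endpoints ≤ r) :
    bottleneckDist B B' ≤ r := by
  refine (iInf_le _ (e.sumCongr (Equiv.refl ℝ))).trans (iSup_le ?_)
  rintro (i | x)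
  · exact h i
  · change max (coordDist (x : EReal) x) (coordDist (x : EReal) x) ≤ r
    rw [coordDist_self, max_self]
    exact zero_le

/-- Convergence of barcodes of grounded modules whose Hilbert functions are interleaved with
geometrically decreasing shifts. -/
theorem exists_limit_barcode {M : ℕ → PersVec} (hM : ∀ n, IsGrounded (M n)) {C : ℝ} (hC : 0 ≤ C)
    (h0 : ∀ n, Module.finrank ℝ ((M (n + 1)).obj 0) = Module.finrank ℝ ((M n).obj 0))
    (h1 : ∀ n (t : ℝ), 0 ≤ t → Module.finrank ℝ ((M (n + 1)).obj (t + C / 2 ^ n)) ≤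
      Module.finrank ℝ ((M n).obj t))
    (h2 : ∀ n (t : ℝ), 0 ≤ t → Module.finrank ℝ ((M n).obj (t + C / 2 ^ n)) ≤
      Module.finrank ℝ ((M (n + 1)).obj t)) :
    ∃ L : Barcode, Finite L.ι ∧ ∀ B : ℕ → Barcode, (∀ n, IsBarcodeOf (B n) (M n)) →
      Tendsto (fun n => bottleneckDist (B n) L) atTop (𝓝 0) := by
  -- The number of bars is the dimension at `0`, so the `k`-th death makes sense at every stage.
  obtain ⟨m, hm⟩ : ∃ m, ∀ n, Module.finrank ℝ ((M n).obj 0) = m := by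
    refine ⟨Module.finrank ℝ ((M 0).obj 0), fun n => ?_⟩
    induction n with
    | zero => rfl
    | succ n ih => rw [h0, ih]
  choose A hA using fun n => (hM n).exists_isBarcodeOf
  choose e he using fun n => (hA n).exists_sorted (hM n) (hm n)
  have hCn : ∀ n : ℕ, 0 ≤ C / 2 ^ n := fun n => div_nonneg hC (by positivity)
  have hlim := fun k => exists_limit_of_geometric (d := fun n => ((A n).bar (e n k)).death) (C := C)
    (fun n => RealInterval.coe_le_death ((hA n).zero_mem (hM n) _))
    (fun n => (hA n).death_le_add (hM n) (hM _) (hA _) (he n) (he _) (hCn n) (h1 n) k)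
    (fun n => (hA _).death_le_add (hM _) (hM n) (hA n) (he _) (he n) (hCn n) (h2 n) k)
  choose D hD0 hD using hlim
  refine ⟨⟨Fin m, fun k => .upTo (D k) (hD0 k)⟩, inferInstanceAs (Finite (Fin m)),
    fun B hB => ?_⟩
  have hto : Tendsto (fun n : ℕ => ENNReal.ofReal (2 * C / 2 ^ n)) atTop (𝓝 0) := by
    rw [← ENNReal.ofReal_zero]
    exact ENNReal.tendsto_ofReal
      (tendsto_const_nhds.div_atTop (tendsto_pow_atTop_atTop_of_one_lt one_lt_two))
  refine tendsto_of_tendsto_of_tendsto_of_le_of_le tendsto_const_nhds hto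
    (fun _ => zero_le) fun n => ?_
  obtain ⟨f, hf⟩ := (hB n).exists_sorted (hM n) (hm n)
  -- Two barcodes of one module have the same sorted deaths, by the comparison with shift `0`. The
  -- limit built from `A` thus serves every choice of `B`.
  have hfe : ∀ k, ((B n).bar (f k)).death = ((A n).bar (e n k)).death := by
    have hle : ∀ t : ℝ, 0 ≤ t →
        Module.finrank ℝ ((M n).obj (t + 0)) ≤ Module.finrank ℝ ((M n).obj t) := by
      intro t _
      rw [add_zero]
    intro k
    refine le_antisymm ?_ ?_
    · simpa using (hA n).death_le_add (hM n) (hM n) (hB n) (he n) hf le_rfl hle k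
    · simpa using (hB n).death_le_add (hM n) (hM n) (hA n) hf (he n) le_rfl hle k
  refine bottleneckDist_le f.symm fun i => ?_
  obtain ⟨k, rfl⟩ := f.surjective i
  rw [Equiv.symm_apply_apply, RealInterval.endpoints_upTo,
    RealInterval.endpoints_eq ((hB n).zero_mem (hM n) _) fun t => (hB n).nonneg (hM n), hfe,
    planeDist, coordDist_self]
  exact max_le zero_le (hD k n)

end GrPPH

end

theorem mainTheorem6 (G : GrPPH.WDigraph) :
    (∀ n : ℕ, ∃ B : GrPPH.Barcode, GrPPH.IsBarcodeOf B (G.iteratedMedial n).grpph) ∧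
      ∃ L : GrPPH.Barcode, Finite L.ι ∧
        ∀ B : ℕ → GrPPH.Barcode,
          (∀ n, GrPPH.IsBarcodeOf (B n) (G.iteratedMedial n).grpph) →
            Tendsto (fun n => GrPPH.bottleneckDist (B n) L) atTop (𝓝 0) := by
  refine ⟨fun n => (G.iteratedMedial n).isGrounded_grpph.exists_isBarcodeOf, ?_⟩
  obtain ⟨c, hc0, hc⟩ := G.exists_weight_le
  have hcn : ∀ n : ℕ, 0 ≤ c / 2 ^ n := fun n => div_nonneg hc0 (by positivity)
  exact GrPPH.exists_limit_barcode (M := fun n => (G.iteratedMedial n).grpph)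
    (fun n => (G.iteratedMedial n).isGrounded_grpph) hc0
    (fun n => (G.iteratedMedial n).finrank_groundedHomology_zero_medial)
    (fun n _ ht => (G.iteratedMedial n).finrank_groundedHomology_medial_add_le (hcn n)
      (G.iteratedMedial_weight_le hc n) ht)
    (fun n _ ht => (G.iteratedMedial n).finrank_groundedHomology_add_le (hcn n)
      (G.iteratedMedial_weight_le hc n) ht)
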